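/- Let $(E,H,\mu)$ be an abstract Wiener space: $H$ is a separable real Hilbert space with norm $|\cdot|$, continuously, injectively and densely embedded into a real Banach space $(E,\|\cdot\|)$, and $\mu$ is a measure on the Borel $\sigma$-algebra of $E$ such that every $l\in E'$ is normally distributed under $\mu$ with mean $0$ and variance $|l|^2$, where $E'\subset H'\equiv H\subset E$. Write $\|i\|$ for the operator norm of the embedding $i:H\to E$. Let $x\in E\setminus H$. (a) There is an orthonormal basis $(e_n)_{n\ge1}$ of $H$ with $e_n\in E'$ for all $n$, which separates the points of $E$ and satisfies $e_n(x)\ge 2^{n/2}$ for all $n\ge1$. (b) For every such basis, put $\widetilde P_nz=\sum_{k=1}^n e_k(z)\,e_k$ for $z\in E$. There is a subsequence $\widetilde Q_n=\widetilde P_{\nu_n}$, $1\le\nu_1<\nu_2<\cdots$, such that for all $n\ge1$ $$\|\mathrm{Id}_H-\widetilde Q_n|_H\|_{\mathcal L(H,E)}\le 2^{-n},\qquad \mu\big(\{z\in E:\|z-\widetilde Q_nz\|>2^{-n}\}\big)\le 2^{-n}.$$ For every basis as in (a) and every subsequence as in (b), put $\widetilde Q_0=0$ and define, for $z\in E$,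 $$q_x(z)=\Big[\sum_{n\ge0}2^n\|\widetilde Q_{n+1}z-\widetilde Q_nz\|^2+\Big(\sum_{n\ge1}2^{-n/2}|e_n(z)|\Big)^2\Big]^{1/2}\in[0,\infty],\qquad E_x=\{z\in E:q_x(z)<\infty\}.$$ Then: (i) $E_x$ is a Borel set and $\mu(E_x)=1$. (ii) $q_x(h)\le\sqrt{2+\|i\|^2}\;|h|$ for all $h\in H$; in particular, if the norms are normalized so that $\|h\|\le|h|$ for all $h\in H$, then $q_x(h)\le\sqrt3\,|h|$ for all $h\in H$. Thus $H\subset E_x$ continuously. (iii) $\|z\|\le\sqrt2\,q_x(z)$ for all $z\in E$; $(E_x,q_x)$ is a complete normed space, and it is compactly embedded into $(E,\|\cdot\|)$. (iv) $((E_x,q_x),H,\mu)$, with $\mu$ restricted to $E_x$, is again an abstract Wiener space, and $q_x\in L^2(E,\mu)$. -/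

import Mathlib

open MeasureTheory ProbabilityTheory
open scoped ENNReal NNReal

noncomputable section

namespace AbstractWiener

section General

variable {H E : Type*} [NormedAddCommGroup H] [InnerProductSpace ℝ H] [CompleteSpace H]
  [NormedAddCommGroup E] [NormedSpace ℝ E]

/-- The canonical map `E' → H' ≡ H`: a continuous functional `l` on `E` is restricted to `H`
along `i : H → E`, and identified with an element of `H` by the Riesz theorem. Hence
`⟪dualToH i l, h⟫ = l (i h)` for all `h`. -/
def dualToH (i : H →L[ℝ] E) (l : StrongDual ℝ E) : H :=
  (InnerProductSpace.toDual ℝ H).symm (l.comp i)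

/-- `(E, H, μ)` is an abstract Wiener space: `H` is a separable Hilbert space, continuously,
injectively and densely embedded by `i` into the Banach space `E`, and every `l ∈ E'` is, under
the Borel measure `μ` on `E`, normally distributed with mean zero and variance `|l|²`, where
`|l|` is the norm of `l` as an element of `H`. -/
structure IsAbstractWienerSpace [MeasurableSpace E] [BorelSpace E]
    (i : H →L[ℝ] E) (μ : Measure E) : Prop where
  separable : TopologicalSpace.SeparableSpace H
  complete : CompleteSpace E
  injective : Function.Injective i
  dense : DenseRange i
  gaussian : ∀ l : StrongDual ℝ E, μ.map l = gaussianReal 0 (‖dualToH i l‖₊ ^ 2)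

/-- An orthonormal basis `e₁, e₂, …` of `H` consisting of elements of `E'` that separates the
points of `E`, and such that `e_n(x) ≥ 2^(n/2)` for all `n ≥ 1`.
The functional `e_n` of the mathematical notation is `e (n - 1)` here. -/
structure CarmonaBasis (i : H →L[ℝ] E) (x : E) where
  e : ℕ → StrongDual ℝ E
  orthonormal : Orthonormal ℝ (fun n => dualToH i (e n))
  total : (Submodule.span ℝ (Set.range fun n => dualToH i (e n))).topologicalClosure = ⊤
  separates : ∀ y z : E, (∀ n, e n y = e n z) → y = z
  growth : ∀ n : ℕ, (2 : ℝ) ^ (((n : ℝ) + 1) / 2) ≤ e n x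

namespace CarmonaBasis

variable {i : H →L[ℝ] E} {x : E} (B : CarmonaBasis i x)

/-- `P̃_n z = ∑_{k=1}^n e_k(z) e_k`, as a map from `E` to `H`. -/
def proj (n : ℕ) : E →L[ℝ] H :=
  ∑ k ∈ Finset.range n, (B.e k).smulRight (dualToH i (B.e k))

/-- The strictly increasing `ν` selects a subsequence `Q̃_n = P̃_{ν n}`, `n ≥ 1`, with
`‖Id_H - Q_n‖_{L(H,E)} ≤ 2⁻ⁿ` and `μ(‖z - Q̃_n z‖ > 2⁻ⁿ) ≤ 2⁻ⁿ` for all `n ≥ 1`.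
The normalization `ν 0 = 0` encodes the convention `Q̃_0 = 0`. -/
structure IsAdmissible [MeasurableSpace E] (μ : Measure E) (ν : ℕ → ℕ) : Prop where
  strictMono : StrictMono ν
  zero : ν 0 = 0
  opNorm_le : ∀ n, 1 ≤ n → ‖i - (i.comp (B.proj (ν n))).comp i‖ ≤ (1 / 2 : ℝ) ^ n
  measure_le : ∀ n, 1 ≤ n →
    μ {z | (1 / 2 : ℝ) ^ n < ‖z - i (B.proj (ν n) z)‖} ≤ (1 / 2 : ℝ≥0∞) ^ n

/-- The extended norm `q_x : E → [0, ∞]`,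
`q_x(z) = [∑_{n ≥ 0} 2ⁿ ‖Q̃_{n+1} z - Q̃_n z‖² + (∑_{n ≥ 1} 2^(-n/2) |e_n(z)|)²]^(1/2)`. -/
def q (ν : ℕ → ℕ) (z : E) : ℝ≥0∞ :=
  ((∑' n : ℕ, (2 : ℝ≥0∞) ^ n * ‖i (B.proj (ν (n + 1)) z) - i (B.proj (ν n) z)‖ₑ ^ 2) +
    (∑' n : ℕ, (2 : ℝ≥0∞) ^ (-(((n : ℝ) + 1) / 2)) * ‖B.e n z‖ₑ) ^ 2) ^ (1 / 2 : ℝ)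

/-- The terms whose `ℓ²`-norm is `q_x(z)`. -/
def qTerm (ν : ℕ → ℕ) (z : E) : ℕ → ℝ≥0∞
  | 0 => ∑' n : ℕ, (2 : ℝ≥0∞) ^ (-(((n : ℝ) + 1) / 2)) * ‖B.e n z‖ₑ
  | n + 1 => (2 : ℝ≥0∞) ^ ((n : ℝ) / 2) * ‖i (B.proj (ν (n + 1)) z) - i (B.proj (ν n) z)‖ₑ

lemma q_eq (ν : ℕ → ℕ) (z : E) :
    B.q ν z = (∫⁻ o, B.qTerm ν z o ^ (2 : ℝ) ∂Measure.count) ^ (1 / 2 : ℝ) := by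
  rw [lintegral_count, q, 
    tsum_eq_zero_add' (f := fun o => B.qTerm ν z o ^ (2 : ℝ)) ENNReal.summable, add_comm]
  congr 2
  · simp [qTerm]
  · refine tsum_congr fun n => ?_
    simp only [qTerm]
    rw [ENNReal.mul_rpow_of_nonneg _ _ (by norm_num), ← ENNReal.rpow_mul,
      div_mul_cancel₀ _ (by norm_num), ENNReal.rpow_natCast, ENNReal.rpow_two]

lemma q_add_le (ν : ℕ → ℕ) (y z : E) : B.q ν (y + z) ≤ B.q ν y + B.q ν z := by
  rw [q_eq, q_eq, q_eq]
  refine le_trans (ENNReal.rpow_le_rpow (lintegral_mono fun o => ENNReal.rpow_le_rpow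
    (z := 2) (?_ : B.qTerm ν (y + z) o ≤ (B.qTerm ν y + B.qTerm ν z) o) (by norm_num))
    (by norm_num)) (ENNReal.lintegral_Lp_add_le (measurable_of_countable _).aemeasurable
      (measurable_of_countable _).aemeasurable (by norm_num))
  rcases o with _ | n
  · simp only [qTerm, Pi.add_apply]
    rw [← ENNReal.tsum_add]
    refine ENNReal.tsum_le_tsum fun n => ?_
    rw [← mul_add, map_add]
    gcongr
    exact enorm_add_le _ _
  · simp only [qTerm, Pi.add_apply, map_add]
    rw [← mul_add, add_sub_add_comm]
    gcongr
    exact enorm_add_le _ _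

lemma q_smul (ν : ℕ → ℕ) (c : ℝ) (z : E) : B.q ν (c • z) = ‖c‖ₑ * B.q ν z := by
  simp only [q, map_smul, ← smul_sub, enorm_smul, mul_pow, mul_left_comm _ ‖c‖ₑ,
    mul_left_comm _ (‖c‖ₑ ^ 2), ENNReal.tsum_mul_left]
  rw [← mul_add, ENNReal.mul_rpow_of_nonneg _ _ (by norm_num), ← ENNReal.rpow_natCast,
    ← ENNReal.rpow_mul]
  norm_num

lemma q_zero (ν : ℕ → ℕ) : B.q ν 0 = 0 := by
  simpa using B.q_smul ν 0 0

lemma eq_zero_of_q_eq_zero (ν : ℕ → ℕ) {z : E} (h : B.q ν z = 0) : z = 0 := by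
  refine B.separates z 0 fun n => ?_
  rw [q, ENNReal.rpow_eq_zero_iff_of_pos (by norm_num), add_eq_zero,
    pow_eq_zero_iff (by norm_num), ENNReal.tsum_eq_zero,
    ENNReal.tsum_eq_zero] at h
  have h2 := (mul_eq_zero.1 (h.2 n)).resolve_left
    (by simp [ENNReal.rpow_eq_zero_iff])
  simpa using h2

/-- The linear subspace `E_x = [q_x < ∞]` of `E`. -/
def subspace (ν : ℕ → ℕ) : Submodule ℝ E where
  carrier := {z | B.q ν z < ∞}
  add_mem' {y z} hy hz := (B.q_add_le ν y z).trans_lt (ENNReal.add_lt_top.2 ⟨hy, hz⟩)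
  zero_mem' := by simp [q_zero]
  smul_mem' c z hz := by
    simp only [Set.mem_ofPred_eq, q_smul] at hz ⊢
    exact ENNReal.mul_lt_top enorm_lt_top hz

/-- The normed space `(E_x, q_x)`; this type synonym of `E_x` does not carry the norm of `E`. -/
def Space (ν : ℕ → ℕ) : Type _ := B.subspace ν

instance (ν : ℕ → ℕ) : AddCommGroup (B.Space ν) :=
  inferInstanceAs (AddCommGroup (B.subspace ν))

instance (ν : ℕ → ℕ) : Module ℝ (B.Space ν) :=
  inferInstanceAs (Module ℝ (B.subspace ν))

/-- The inclusion `E_x ⊂ E`. -/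
def incl (ν : ℕ → ℕ) : B.Space ν →ₗ[ℝ] E := (B.subspace ν).subtype

instance (ν : ℕ → ℕ) : Norm (B.Space ν) := ⟨fun z => (B.q ν (B.incl ν z)).toReal⟩

lemma q_incl_ne_top (ν : ℕ → ℕ) (z : B.Space ν) : B.q ν (B.incl ν z) ≠ ∞ :=
  ne_of_lt (show B.q ν (B.incl ν z) < ∞ from z.2)

lemma core (ν : ℕ → ℕ) : NormedSpace.Core ℝ (B.Space ν) where
  norm_nonneg _ := ENNReal.toReal_nonneg
  norm_smul c z := by
    change (B.q ν (B.incl ν (c • z))).toReal = ‖c‖ * (B.q ν (B.incl ν z)).toReal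
    rw [map_smul, q_smul, ENNReal.toReal_mul, toReal_enorm]
  norm_triangle y z := by
    change (B.q ν (B.incl ν (y + z))).toReal ≤
      (B.q ν (B.incl ν y)).toReal + (B.q ν (B.incl ν z)).toReal
    rw [map_add, ← ENNReal.toReal_add (B.q_incl_ne_top ν y) (B.q_incl_ne_top ν z)]
    exact ENNReal.toReal_mono
      (ENNReal.add_ne_top.2 ⟨B.q_incl_ne_top ν y, B.q_incl_ne_top ν z⟩) (B.q_add_le ν _ _)
  norm_eq_zero_iff z := by
    change (B.q ν (B.incl ν z)).toReal = 0 ↔ z = 0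
    constructor
    · intro h
      have h0 := ((ENNReal.toReal_eq_zero_iff _).1 h).resolve_right (B.q_incl_ne_top ν z)
      exact Subtype.ext (B.eq_zero_of_q_eq_zero ν h0)
    · rintro rfl
      simp [q_zero]

/-- The norm of `(E_x, q_x)` is `q_x`. -/
instance (ν : ℕ → ℕ) : NormedAddCommGroup (B.Space ν) := NormedAddCommGroup.ofCore (B.core ν)

instance (ν : ℕ → ℕ) : NormedSpace ℝ (B.Space ν) := NormedSpace.ofCore (B.core ν)

instance (ν : ℕ → ℕ) : MeasurableSpace (B.Space ν) := borel _

instance (ν : ℕ → ℕ) : BorelSpace (B.Space ν) := ⟨rfl⟩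

lemma norm_eq (ν : ℕ → ℕ) (z : B.Space ν) : ‖z‖ = (B.q ν (B.incl ν z)).toReal := rfl

end CarmonaBasis

end General

end AbstractWiener

end

noncomputable section

namespace AbstractWiener

open Filter Topology

/-! ### Functionals as elements of `H`, and the construction of the basis. -/

section Dual

variable {H E : Type*} [NormedAddCommGroup H] [InnerProductSpace ℝ H] [CompleteSpace H]
  [NormedAddCommGroup E] [NormedSpace ℝ E] (i : H →L[ℝ] E)

/-! Existence of the basis. If `x ∉ H`, then evaluation at `x` is unbounded on `E'` for the norm of
`H`; otherwise Hahn-Banach and Riesz would represent it by an element of `H`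
(`exists_lt_abs_apply`). Unboundedness survives orthogonalization against finitely many functionals.
A direction needed for separating points, on whose value at `x` there is no control, can thus be
rotated by 45 degrees against an orthogonal one with a huge value at `x`; both resulting unit
vectors are large at `x` (`exists_orthonormal_pair`).

Existence of the subsequence. The reflection `2 P̃_n - 1` preserves `μ`, so `z - P̃_n z`, half the
difference of `z` and its reflection, is tight uniformly in `n`. All its fixed coordinates
eventually vanish and the `e_k` separate points, hence it tends to zero in measure. For Gaussian
functionals, smallness in measure forces smallness in `H`, which upgrades this to operator norm
convergence on `H`.

Properties of `q_x`. The weights `2^n` turn finiteness of `q_x(z)` into absolute convergence of the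
telescoping series of increments, with geometric tails: this gives the comparison with the norm of
`E`, and compactness as a norm limit of finite rank maps. Lower semicontinuity gives completeness.
Square integrability, hence full measure, comes from Fernique's theorem with a constant uniform over
all increments. Finally `Q̃_m z → z` in `E_x`, so `H` is dense there, and every functional on `E_x`
is a pointwise limit of functionals on `E`, which identifies its law. -/

lemma inner_dualToH (l : StrongDual ℝ E) (h : H) : inner ℝ (dualToH i l) h = l (i h) := by
  simp [dualToH]

lemma dualToH_add (l m : StrongDual ℝ E) : dualToH i (l + m) = dualToH i l + dualToH i m := by
  simp [dualToH]

lemma dualToH_smul (c : ℝ) (l : StrongDual ℝ E) : dualToH i (c • l) = c • dualToH i l := by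
  simp [dualToH]

/-- `dualToH` as a linear map. -/
def dualToHₗ : StrongDual ℝ E →ₗ[ℝ] H where
  toFun := dualToH i
  map_add' := dualToH_add i
  map_smul' := dualToH_smul i

lemma dualToHₗ_apply (l : StrongDual ℝ E) : dualToHₗ i l = dualToH i l := rfl

lemma dualToH_sub (l m : StrongDual ℝ E) : dualToH i (l - m) = dualToH i l - dualToH i m :=
  map_sub (dualToHₗ i) l m

lemma dualToH_sum {ι : Type*} (s : Finset ι) (f : ι → StrongDual ℝ E) :
    dualToH i (∑ k ∈ s, f k) = ∑ k ∈ s, dualToH i (f k) :=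
  map_sum (dualToHₗ i) f s

variable {i}

lemma dualToHₗ_injective (hi : DenseRange i) : Function.Injective (dualToHₗ i) := by
  rw [← LinearMap.ker_eq_bot, LinearMap.ker_eq_bot']
  intro l hl
  have h0 : ∀ h, l (i h) = 0 := fun h => by
    rw [← inner_dualToH, ← dualToHₗ_apply, hl, inner_zero_left]
  refine ContinuousLinearMap.ext fun z => ?_
  exact congrFun (hi.equalizer l.continuous continuous_zero (funext h0)) z

/-- Evaluation at a point which does not belong to `H` is unbounded for the norm of `H`. -/
lemma exists_lt_abs_apply (hi : DenseRange i) {x : E} (hx : x ∉ Set.range i) (C : ℝ) :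
    ∃ l : StrongDual ℝ E, C * ‖dualToH i l‖ < |l x| := by
  by_contra! hC
  let e := LinearEquiv.ofInjective (dualToHₗ i) (dualToHₗ_injective hi)
  let φ : (dualToHₗ i).range →ₗ[ℝ] ℝ :=
    ((ContinuousLinearMap.apply ℝ ℝ x).toLinearMap).comp e.symm.toLinearMap
  have hφ : ∀ y, ‖φ y‖ ≤ C * ‖y‖ := by
    intro y
    obtain ⟨l, rfl⟩ := e.surjective y
    have hl : φ (e l) = l x := by simp [φ]
    rw [hl]
    exact hC l
  -- Evaluation at `x` is bounded on the image of `E'` in `H`; the Riesz representative of an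
  -- extension to `H` is then mapped by `i` to `x`.
  obtain ⟨g, hg, -⟩ := exists_extension_norm_eq (𝕜 := ℝ) _ (φ.mkContinuous C hφ)
  refine hx ⟨(InnerProductSpace.toDual ℝ H).symm g, ?_⟩
  refine (SeparatingDual.eq_iff_forall_dual_eq (R := ℝ)).2 fun l => ?_
  rw [← inner_dualToH, real_inner_comm, InnerProductSpace.toDual_symm_apply]
  have h1 : φ (e l) = l x := by simp [φ]
  exact (hg (e l)).trans h1

/-- In the orthogonal complement of finitely many functionals, evaluation at `x ∉ H` is unbounded
on the unit sphere of `H`. -/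
lemma exists_orthogonal_le_apply (hi : DenseRange i) {x : E} (hx : x ∉ Set.range i)
    {n : ℕ} {e : ℕ → StrongDual ℝ E}
    (he : ∀ j < n, ∀ k < n, inner ℝ (dualToH i (e j)) (dualToH i (e k)) = if j = k then 1 else 0)
    (M : ℝ) :
    ∃ g : StrongDual ℝ E, (∀ k < n, inner ℝ (dualToH i (e k)) (dualToH i g) = 0) ∧
      ‖dualToH i g‖ = 1 ∧ M ≤ g x := by
  suffices h : ∃ g : StrongDual ℝ E, (∀ k < n, inner ℝ (dualToH i (e k)) (dualToH i g) = 0) ∧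
      |M| * ‖dualToH i g‖ < |g x| by
    obtain ⟨g, hg, hM⟩ := h
    have hg0 : 0 < ‖dualToH i g‖ := by
      rw [norm_pos_iff]
      intro h0
      have : g = 0 := dualToHₗ_injective hi (by rw [dualToHₗ_apply, h0, map_zero])
      rw [h0, this] at hM
      simp at hM
    obtain ⟨s, hs, hsx⟩ : ∃ s : ℝ, |s| = 1 ∧ s * g x = |g x| := by
      rcases le_total 0 (g x) with h | h
      · exact ⟨1, by simp, by rw [abs_of_nonneg h, one_mul]⟩
      · exact ⟨-1, by simp, by rw [abs_of_nonpos h]; ring⟩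
    refine ⟨(s * ‖dualToH i g‖⁻¹) • g, fun k hk => ?_, ?_, ?_⟩
    · rw [dualToH_smul, inner_smul_right, hg k hk, mul_zero]
    · rw [dualToH_smul, norm_smul, norm_mul, Real.norm_eq_abs, hs, one_mul, norm_inv, norm_norm,
        inv_mul_cancel₀ hg0.ne']
    · have : ((s * ‖dualToH i g‖⁻¹) • g) x = |g x| / ‖dualToH i g‖ := by
        rw [← hsx]; simp; ring
      rw [this, le_div_iff₀ hg0]
      exact (mul_le_mul_of_nonneg_right (le_abs_self M) hg0.le).trans hM.le
  -- The constant pays for Gram-Schmidt: the correction multiplies the norm by at most `1 + n` and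
  -- changes the value at `x` by at most `(∑ |e k x|) * ‖dualToH i l‖`.
  obtain ⟨l, hl⟩ := exists_lt_abs_apply hi hx
    (|M| * (1 + n) + ∑ k ∈ Finset.range n, |e k x|)
  set g := l - ∑ k ∈ Finset.range n, inner ℝ (dualToH i (e k)) (dualToH i l) • e k with hg
  have hTg : dualToH i g = dualToH i l -
      ∑ k ∈ Finset.range n, inner ℝ (dualToH i (e k)) (dualToH i l) • dualToH i (e k) := by
    simp only [hg, dualToH_sub, dualToH_sum, dualToH_smul]
  have h1 : ∀ k < n, ‖dualToH i (e k)‖ = 1 := fun k hk => by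
    have := he k hk k hk
    rw [if_pos rfl, real_inner_self_eq_norm_sq] at this
    nlinarith [norm_nonneg (dualToH i (e k))]
  have hin : ∀ k < n, |inner ℝ (dualToH i (e k)) (dualToH i l)| ≤ ‖dualToH i l‖ := fun k hk => by
    simpa [h1 k hk] using abs_real_inner_le_norm (dualToH i (e k)) (dualToH i l)
  refine ⟨g, fun k hk => ?_, ?_⟩
  · rw [hTg, inner_sub_right, inner_sum, Finset.sum_eq_single k]
    · rw [inner_smul_right, he k hk k hk]; simp
    · intro j hj hjk
      rw [inner_smul_right, he k hk j (Finset.mem_range.1 hj), if_neg hjk.symm, mul_zero]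
    · simp [hk]
  · have hn : ‖dualToH i g‖ ≤ (1 + n) * ‖dualToH i l‖ := by
      rw [hTg, add_mul, one_mul]
      refine (norm_sub_le _ _).trans (add_le_add le_rfl ((norm_sum_le _ _).trans ?_))
      refine (Finset.sum_le_card_nsmul _ _ ‖dualToH i l‖ fun k hk => ?_).trans (by simp)
      rw [norm_smul, h1 k (Finset.mem_range.1 hk), mul_one]
      exact hin k (Finset.mem_range.1 hk)
    have hlx : |l x| ≤ |g x| + (∑ k ∈ Finset.range n, |e k x|) * ‖dualToH i l‖ := by
      have : l x = g x + ∑ k ∈ Finset.range n, inner ℝ (dualToH i (e k)) (dualToH i l) * e k x := by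
        simp [hg]
      rw [this]
      refine (abs_add_le _ _).trans (add_le_add le_rfl ((Finset.abs_sum_le_sum_abs _ _).trans ?_))
      rw [Finset.sum_mul]
      refine Finset.sum_le_sum fun k hk => ?_
      rw [abs_mul, mul_comm]
      exact mul_le_mul_of_nonneg_left (hin k (Finset.mem_range.1 hk)) (abs_nonneg _)
    nlinarith [mul_le_mul_of_nonneg_left hn (abs_nonneg M)]

/-- Two further orthonormal functionals which are large at `x ∉ H` and which, together with the
given ones, span a given functional. -/
lemma exists_orthonormal_pair (hi : DenseRange i) {x : E} (hx : x ∉ Set.range i)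
    {n : ℕ} {e : ℕ → StrongDual ℝ E}
    (he : ∀ j < n, ∀ k < n, inner ℝ (dualToH i (e j)) (dualToH i (e k)) = if j = k then 1 else 0)
    (f : StrongDual ℝ E) (M : ℝ) :
    ∃ u v : StrongDual ℝ E, (∀ k < n, inner ℝ (dualToH i (e k)) (dualToH i u) = 0) ∧
      (∀ k < n, inner ℝ (dualToH i (e k)) (dualToH i v) = 0) ∧
      ‖dualToH i u‖ = 1 ∧ ‖dualToH i v‖ = 1 ∧ inner ℝ (dualToH i u) (dualToH i v) = 0 ∧
      M ≤ u x ∧ M ≤ v x ∧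
      ∀ z, (∀ k < n, e k z = 0) → u z = 0 → v z = 0 → f z = 0 := by
  obtain ⟨w, hw, hw1, hwf⟩ : ∃ w : StrongDual ℝ E,
      (∀ k < n, inner ℝ (dualToH i (e k)) (dualToH i w) = 0) ∧ ‖dualToH i w‖ = 1 ∧
      ∀ z, (∀ k < n, e k z = 0) → w z = 0 → f z = 0 := by
    set g := f - ∑ k ∈ Finset.range n, inner ℝ (dualToH i (e k)) (dualToH i f) • e k with hg
    have hgf : ∀ z, (∀ k < n, e k z = 0) → g z = f z := fun z hz => by
      simp only [hg, sub_apply, sum_apply, smul_apply, sub_eq_self]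
      exact Finset.sum_eq_zero fun k hk => by rw [hz k (Finset.mem_range.1 hk), smul_zero]
    have hort : ∀ k < n, inner ℝ (dualToH i (e k)) (dualToH i g) = 0 := fun k hk => by
      rw [hg, dualToH_sub, dualToH_sum, inner_sub_right, inner_sum, Finset.sum_eq_single k]
      · rw [dualToH_smul, inner_smul_right, he k hk k hk]; simp
      · intro j hj hjk
        rw [dualToH_smul, inner_smul_right, he k hk j (Finset.mem_range.1 hj), if_neg hjk.symm,
          mul_zero]
      · simp [hk]
    -- If `f` is already in the span of the `e k`, any orthogonal unit functional can serve as `w`.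
    by_cases h0 : dualToH i g = 0
    · have hg0 : g = 0 := dualToHₗ_injective hi (by rw [dualToHₗ_apply, h0, map_zero])
      obtain ⟨w, hw, hw1, -⟩ := exists_orthogonal_le_apply hi hx he 0
      exact ⟨w, hw, hw1, fun z hz _ => by rw [← hgf z hz, hg0]; rfl⟩
    · refine ⟨‖dualToH i g‖⁻¹ • g, fun k hk => ?_, ?_, fun z hz hgz => ?_⟩
      · rw [dualToH_smul, inner_smul_right, hort k hk, mul_zero]
      · rw [dualToH_smul, norm_smul, norm_inv, norm_norm,
          inv_mul_cancel₀ (norm_ne_zero_iff.2 h0)]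
      · rw [← hgf z hz]
        simpa [h0] using hgz
  have hs : √2 * √2 = (2 : ℝ) := Real.mul_self_sqrt (by norm_num)
  have hs0 : 0 < √(2 : ℝ) := by positivity
  -- The lower bound is chosen so that `(g ± w) / √2` both exceed `M` at `x`, whatever the sign of
  -- `w x`. The plane spanned by `g` and `w`, and hence the common kernel, is unchanged by this
  -- rotation.
  obtain ⟨g, hg, hg1, hgx⟩ := exists_orthogonal_le_apply hi hx (n := n + 1)
    (e := fun k => if k < n then e k else w) (by
      intro j hj k hk
      rcases Nat.lt_succ_iff_lt_or_eq.1 hj with hj | rfl <;>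
        rcases Nat.lt_succ_iff_lt_or_eq.1 hk with hk | rfl
      · simpa [hj, hk] using he j hj k hk
      · simp [hj, hw j hj, hj.ne]
      · simp only [lt_irrefl, if_false, hk, if_true, hk.ne']
        rw [real_inner_comm, hw k hk]
      · simp [hw1]) (|w x| + √2 * |M|)
  have hge : ∀ k < n, inner ℝ (dualToH i (e k)) (dualToH i g) = 0 := fun k hk => by
    simpa [hk] using hg k (by omega)
  have hgw : inner ℝ (dualToH i w) (dualToH i g) = 0 := by simpa using hg n (by omega)
  have hgw' : inner ℝ (dualToH i g) (dualToH i w) = 0 := by rw [real_inner_comm, hgw]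
  have hn : ∀ y : H, inner ℝ y y = 1 → ‖y‖ = 1 := fun y hy => by
    rw [real_inner_self_eq_norm_sq] at hy
    nlinarith [norm_nonneg y]
  have hgg : inner ℝ (dualToH i g) (dualToH i g) = 1 := by
    rw [real_inner_self_eq_norm_sq, hg1, one_pow]
  have hww : inner ℝ (dualToH i w) (dualToH i w) = 1 := by
    rw [real_inner_self_eq_norm_sq, hw1, one_pow]
  have hinv : (√2)⁻¹ * (√2)⁻¹ = (1 / 2 : ℝ) := by rw [← mul_inv, hs]; norm_num
  refine ⟨(√2)⁻¹ • (g + w), (√2)⁻¹ • (g - w), fun k hk => ?_, fun k hk => ?_, hn _ ?_, hn _ ?_, ?_,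
    ?_, ?_, fun z hz hu hv => hwf z hz ?_⟩
  · rw [dualToH_smul, dualToH_add, inner_smul_right, inner_add_right, hge k hk, hw k hk]; simp
  · rw [dualToH_smul, dualToH_sub, inner_smul_right, inner_sub_right, hge k hk, hw k hk]; simp
  · rw [dualToH_smul, dualToH_add, real_inner_smul_left, inner_smul_right, ← mul_assoc, hinv]
    simp only [inner_add_left, inner_add_right, hgg, hww, hgw, hgw']; norm_num
  · rw [dualToH_smul, dualToH_sub, real_inner_smul_left, inner_smul_right, ← mul_assoc, hinv]
    simp only [inner_sub_left, inner_sub_right, hgg, hww, hgw, hgw']; norm_num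
  · rw [dualToH_smul, dualToH_smul, dualToH_sub, dualToH_add, real_inner_smul_left,
      inner_smul_right]
    simp only [inner_sub_right, inner_add_left, hgg, hww, hgw, hgw']; norm_num
  · have : ((√2)⁻¹ • (g + w)) x = (g x + w x) / √2 := by simp; ring
    rw [this, le_div_iff₀ hs0]
    nlinarith [neg_abs_le (w x), le_abs_self M]
  · have : ((√2)⁻¹ • (g - w)) x = (g x - w x) / √2 := by simp; ring
    rw [this, le_div_iff₀ hs0]
    nlinarith [le_abs_self (w x), le_abs_self M]
  · have hu' : g z + w z = 0 :=
      (smul_eq_zero.1 (show (√2)⁻¹ • (g z + w z) = 0 from hu)).resolve_left (inv_ne_zero hs0.ne')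
    have hv' : g z - w z = 0 :=
      (smul_eq_zero.1 (show (√2)⁻¹ • (g z - w z) = 0 from hv)).resolve_left (inv_ne_zero hs0.ne')
    linarith

/-- A separable normed space has a sequence of functionals which separates points. -/
lemma exists_separating_seq (E : Type*) [NormedAddCommGroup E] [NormedSpace ℝ E]
    [TopologicalSpace.SeparableSpace E] :
    ∃ l : ℕ → StrongDual ℝ E, ∀ z, (∀ n, l n z = 0) → z = 0 := by
  choose l hl1 hl2 using fun n => exists_dual_vector'' ℝ (TopologicalSpace.denseSeq E n)
  refine ⟨l, fun z hz => ?_⟩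
  by_contra h0
  have hpos : 0 < ‖z‖ := norm_pos_iff.2 h0
  obtain ⟨n, hn⟩ := (TopologicalSpace.denseRange_denseSeq E).exists_dist_lt z (half_pos hpos)
  set d := TopologicalSpace.denseSeq E n
  rw [dist_eq_norm] at hn
  have h1 : ‖d‖ ≤ ‖z - d‖ := by
    have h2 : l n (d - z) = ‖d‖ := by rw [map_sub, hz n, sub_zero]; exact hl2 n
    calc ‖d‖ ≤ ‖l n (d - z)‖ := by rw [h2]; simp
      _ ≤ 1 * ‖d - z‖ := (l n).le_of_opNorm_le (hl1 n) _
      _ = ‖z - d‖ := by rw [one_mul, norm_sub_rev]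
  have h3 : ‖z‖ ≤ ‖z - d‖ + ‖d‖ := by simpa using norm_add_le (z - d) d
  linarith

/-- Stage `n` appends two functionals, which bring the `n`-th member of a separating sequence into
the span. Separation of points of `E` implies totality in `H`, because a vector of `H` orthogonal to
every `e n` is annihilated by every `e n`. -/
lemma exists_carmonaBasis [TopologicalSpace.SeparableSpace H] (hinj : Function.Injective i)
    (hi : DenseRange i) {x : E} (hx : x ∉ Set.range i) : Nonempty (CarmonaBasis i x) := by
  have : TopologicalSpace.SeparableSpace E := hi.separableSpace i.continuous
  obtain ⟨l, hl⟩ := exists_separating_seq E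
  let good : ℕ → (ℕ → StrongDual ℝ E) → Prop := fun n e =>
    (∀ j < 2 * n, ∀ k < 2 * n,
      inner ℝ (dualToH i (e j)) (dualToH i (e k)) = if j = k then 1 else 0) ∧
    ∀ k < 2 * n, (2 : ℝ) ^ (((k : ℝ) + 1) / 2) ≤ e k x
  have step : ∀ n e, good n e → ∃ e', good (n + 1) e' ∧ (∀ k < 2 * n, e' k = e k) ∧
      ∀ z, (∀ k < 2 * (n + 1), e' k z = 0) → l n z = 0 := by
    rintro n e ⟨he, hex⟩
    -- The threshold is the one required at index `2 * n + 1`, the larger of the two.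
    obtain ⟨u, v, heu, hev, hu, hv, huv, hux, hvx, hz⟩ :=
      exists_orthonormal_pair hi hx he (l n) ((2 : ℝ) ^ (((2 * n : ℕ) + 1 + 1 : ℝ) / 2))
    let e' : ℕ → StrongDual ℝ E := fun k => if k < 2 * n then e k else if k = 2 * n then u else v
    have h1 : ∀ k < 2 * n, e' k = e k := fun k hk => by simp [e', hk]
    have h2 : e' (2 * n) = u := by simp [e']
    have h3 : e' (2 * n + 1) = v := by simp [e']
    have hcase : ∀ k < 2 * (n + 1), k < 2 * n ∨ k = 2 * n ∨ k = 2 * n + 1 := by omega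
    refine ⟨e', ⟨fun j hj k hk => ?_, fun k hk => ?_⟩, h1, fun z hz' => hz z
      (fun k hk => by rw [← h1 k hk]; exact hz' k (by omega))
      (by rw [← h2]; exact hz' (2 * n) (by omega))
      (by rw [← h3]; exact hz' (2 * n + 1) (by omega))⟩
    · wlog hjk : j ≤ k generalizing j k
      · rw [real_inner_comm, this k hk j hj (le_of_not_ge hjk)]
        simp only [eq_comm]
      rcases hcase j hj with hj | rfl | rfl <;> rcases hcase k hk with hk | rfl | rfl
      · rw [h1 j hj, h1 k hk, he j hj k hk]
      · rw [h1 j hj, h2, heu j hj, if_neg (by omega)]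
      · rw [h1 j hj, h3, hev j hj, if_neg (by omega)]
      · omega
      · rw [h2, if_pos rfl, real_inner_self_eq_norm_sq, hu, one_pow]
      · rw [h2, h3, huv, if_neg (by omega)]
      · omega
      · omega
      · rw [h3, if_pos rfl, real_inner_self_eq_norm_sq, hv, one_pow]
    · rcases hcase k hk with hk | rfl | rfl
      · rw [h1 k hk]; exact hex k hk
      · rw [h2]
        refine le_trans (Real.rpow_le_rpow_of_exponent_le (by norm_num) ?_) hux
        linarith
      · rw [h3]
        refine le_trans (Real.rpow_le_rpow_of_exponent_le (by norm_num) ?_) hvx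
        push_cast; linarith
  choose! next hn1 hn2 hn3 using step
  let F : ∀ n, ℕ → StrongDual ℝ E := fun n => Nat.rec (fun _ => 0) (fun n e => next n e) n
  have hF : ∀ n, good n (F n) := fun n => by
    induction n with
    | zero => exact ⟨by simp, by simp⟩
    | succ n ih => exact hn1 n _ ih
  have hag : ∀ n m, n ≤ m → ∀ k < 2 * n, F m k = F n k := by
    intro n m hnm
    induction m, hnm using Nat.le_induction with
    | base => exact fun _ _ => rfl
    | succ m hm ih => exact fun k hk => (hn2 m _ (hF m) k (by omega)).trans (ih k hk)
  -- Stage `k + 1` has fixed the first `2 * (k + 1)` entries, so entry `k` is final there.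
  let e : ℕ → StrongDual ℝ E := fun k => F (k + 1) k
  have heF : ∀ n, ∀ k < 2 * n, e k = F n k := fun n k hk => by
    rcases le_total n (k + 1) with h | h
    · exact hag _ _ h k hk
    · exact (hag _ _ h k (by omega)).symm
  have hsep : ∀ z, (∀ n, e n z = 0) → z = 0 := fun z hz => hl z fun n =>
    hn3 n _ (hF n) z fun k hk => by
      rw [← hz k, heF (n + 1) k hk]
  refine ⟨⟨e, ?_, ?_, fun y z hyz => ?_, fun n => ?_⟩⟩
  · rw [orthonormal_iff_ite]
    intro j k
    rw [heF (max j k + 1) j (by omega), heF (max j k + 1) k (by omega)]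
    exact (hF (max j k + 1)).1 j (by omega) k (by omega)
  · rw [Submodule.topologicalClosure_eq_top_iff, Submodule.eq_bot_iff]
    intro h hh
    refine hinj ((hsep _ fun n => ?_).trans (map_zero i).symm)
    rw [← inner_dualToH]
    exact Submodule.inner_right_of_mem_orthogonal (Submodule.subset_span (Set.mem_range_self n)) hh
  · exact sub_eq_zero.1 (hsep _ fun n => by rw [map_sub, hyz n, sub_self])
  · exact (hF (n + 1)).2 n (by omega)

end Dual

/-! ### The partial sum projections and their reflections. -/

namespace CarmonaBasis

variable {H E : Type*} [NormedAddCommGroup H] [InnerProductSpace ℝ H] [CompleteSpace H]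
  [NormedAddCommGroup E] [NormedSpace ℝ E] {i : H →L[ℝ] E} {x : E} (B : CarmonaBasis i x)

lemma proj_apply (n : ℕ) (z : E) :
    B.proj n z = ∑ k ∈ Finset.range n, B.e k z • dualToH i (B.e k) := by
  simp [proj]

lemma e_proj (k n : ℕ) (z : E) :
    B.e k (i (B.proj n z)) = if k < n then B.e k z else 0 := by
  rw [← inner_dualToH, proj_apply, inner_sum]
  simp only [inner_smul_right, orthonormal_iff_ite.1 B.orthonormal, mul_ite, mul_one, mul_zero,
    Finset.sum_ite_eq, Finset.mem_range]

lemma proj_proj (m n : ℕ) (z : E) : B.proj m (i (B.proj n z)) = B.proj (min m n) z := by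
  rw [B.proj_apply m, B.proj_apply (min m n)]
  simp only [e_proj, ite_smul, zero_smul]
  rw [← Finset.sum_filter]
  congr 1
  ext k
  simp

lemma proj_sub_proj {m n : ℕ} (h : n ≤ m) (z : E) :
    B.proj m z - B.proj n z = ∑ k ∈ Finset.Ico n m, B.e k z • dualToH i (B.e k) := by
  rw [proj_apply, proj_apply, Finset.sum_Ico_eq_sub _ h]

lemma norm_proj_sub_proj_le {m n : ℕ} (hmn : n ≤ m) (h : H) :
    ‖B.proj m (i h) - B.proj n (i h)‖ ≤ ‖h‖ := by
  have key : inner ℝ (B.proj m (i h) - B.proj n (i h)) h =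
      inner ℝ (B.proj m (i h) - B.proj n (i h)) (B.proj m (i h) - B.proj n (i h)) := by
    rw [proj_sub_proj B hmn, B.orthonormal.inner_sum, sum_inner]
    refine Finset.sum_congr rfl fun k _ => ?_
    rw [real_inner_smul_left, inner_dualToH]
    simp
  rw [real_inner_self_eq_norm_sq] at key
  have := real_inner_le_norm (B.proj m (i h) - B.proj n (i h)) h
  rw [key, sq] at this
  rcases (norm_nonneg (B.proj m (i h) - B.proj n (i h))).eq_or_lt with h0 | h0
  · rw [← h0]; exact norm_nonneg h
  · exact le_of_mul_le_mul_left this h0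

lemma tendsto_proj (h : H) : Tendsto (fun n => B.proj n (i h)) atTop (𝓝 h) := by
  let b := HilbertBasis.mk B.orthonormal B.total.ge
  refine (b.hasSum_repr h).tendsto_sum_nat.congr fun n => ?_
  rw [proj_apply]
  refine Finset.sum_congr rfl fun k _ => ?_
  rw [b.repr_apply_apply]
  simp only [b, HilbertBasis.coe_mk, inner_dualToH]

lemma inner_proj_left (n : ℕ) (g h : H) :
    inner ℝ (B.proj n (i g)) h = inner ℝ g (B.proj n (i h)) := by
  rw [proj_apply, proj_apply, sum_inner, inner_sum]
  refine Finset.sum_congr rfl fun k _ => ?_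
  rw [real_inner_smul_left, inner_smul_right, inner_dualToH, real_inner_comm, inner_dualToH,
    mul_comm]

lemma dualToH_comp_proj (l : StrongDual ℝ E) (n : ℕ) :
    dualToH i (l.comp (i.comp (B.proj n))) = B.proj n (i (dualToH i l)) := by
  refine ext_inner_right ℝ fun h => ?_
  rw [inner_dualToH, inner_proj_left, inner_dualToH]
  rfl

/-- The reflection `z ↦ 2 P̃_n z - z` of `E`. -/
def reflection (n : ℕ) : E →L[ℝ] E := (2 : ℝ) • i.comp (B.proj n) - ContinuousLinearMap.id ℝ E

lemma reflection_apply (n : ℕ) (z : E) : B.reflection n z = (2 : ℝ) • i (B.proj n z) - z := rfl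

/-- On `H` the map is `2 P - 1` with `P` an orthogonal projection, hence isometric and self-adjoint.
This is the hypothesis under which `map_eq_self` gives invariance of `μ`. -/
lemma norm_dualToH_comp_reflection (l : StrongDual ℝ E) (n : ℕ) :
    ‖dualToH i (l.comp (B.reflection n))‖ = ‖dualToH i l‖ := by
  have h : l.comp (B.reflection n) = (2 : ℝ) • l.comp (i.comp (B.proj n)) - l := by
    ext z; simp [reflection_apply]
  have hP := B.inner_proj_left n (dualToH i l) (B.proj n (i (dualToH i l)))
  rw [proj_proj, min_self, real_inner_comm (B.proj n (i (dualToH i l))) (dualToH i l),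
    real_inner_self_eq_norm_sq] at hP
  rw [h, dualToH_sub, dualToH_smul, dualToH_comp_proj, ← sq_eq_sq₀ (norm_nonneg _) (norm_nonneg _),
    norm_sub_sq_real, norm_smul, real_inner_smul_left, ← hP]
  simp; ring

end CarmonaBasis

/-! ### Convergence in measure and in operator norm; choice of the subsequence. -/

section Gaussian

variable {H E : Type*} [NormedAddCommGroup H] [InnerProductSpace ℝ H] [CompleteSpace H]
  [NormedAddCommGroup E] [NormedSpace ℝ E] [MeasurableSpace E] [BorelSpace E]
  {i : H →L[ℝ] E} {μ : Measure E}

namespace IsAbstractWienerSpace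

lemma isGaussian (hW : IsAbstractWienerSpace i μ) : IsGaussian μ :=
  isGaussian_of_map_eq_gaussianReal fun l => ⟨_, _, hW.gaussian l⟩

lemma integral_dual_eq_zero (hW : IsAbstractWienerSpace i μ) (l : StrongDual ℝ E) :
    ∫ z, l z ∂μ = 0 := by
  have h : ∫ y, y ∂(μ.map l) = 0 := by rw [hW.gaussian l, integral_id_gaussianReal]
  rwa [integral_map (by fun_prop) (by fun_prop)] at h

lemma charFunDual_eq (hW : IsAbstractWienerSpace i μ) (l : StrongDual ℝ E) :
    charFunDual μ l = Complex.exp (-(‖dualToH i l‖ : ℂ) ^ 2 / 2) := by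
  rw [charFunDual_eq_charFun_map_one, hW.gaussian l, charFun_gaussianReal]
  congr 1
  simp [neg_div]

lemma secondCountable (hW : IsAbstractWienerSpace i μ) : SecondCountableTopology E := by
  have := hW.separable
  have : TopologicalSpace.SeparableSpace E := hW.dense.separableSpace i.continuous
  exact UniformSpace.secondCountable_of_separable E

/-- A continuous linear map which preserves the norm of `H` on the dual space preserves `μ`. -/
lemma map_eq_self (hW : IsAbstractWienerSpace i μ) (S : E →L[ℝ] E)
    (hS : ∀ l : StrongDual ℝ E, ‖dualToH i (l.comp S)‖ = ‖dualToH i l‖) : μ.map S = μ := by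
  have := hW.isGaussian
  have := hW.secondCountable
  have := hW.complete
  have : IsProbabilityMeasure (μ.map S) := Measure.isProbabilityMeasure_map (by fun_prop)
  refine Measure.ext_of_charFunDual (funext fun l => ?_)
  rw [charFunDual_map, hW.charFunDual_eq, hW.charFunDual_eq, hS]

variable {x : E}

/-- The series `∑ e_k(z) e_k` converges to `z` in measure. -/
lemma tendsto_measure_lt_norm_sub_proj (hW : IsAbstractWienerSpace i μ) (B : CarmonaBasis i x)
    {ε : ℝ} (hε : 0 < ε) :
    Tendsto (fun n => μ {z | ε < ‖z - i (B.proj n z)‖}) atTop (𝓝 0) := by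
  have := hW.isGaussian
  have := hW.secondCountable
  have := hW.complete
  rw [ENNReal.tendsto_atTop_zero]
  intro δ hδ
  obtain ⟨K, hK, hKμ⟩ := isTightMeasureSet_iff_exists_isCompact_measure_compl_le.1
    (isTightMeasureSet_singleton (μ := μ)) (δ / 2) (ENNReal.half_pos hδ.ne')
  replace hKμ := hKμ μ rfl
  -- Off a set of measure at most `δ`, the remainder lies in the compact set `(K - K) / 2`. Its part
  -- of norm at least `ε` avoids zero, so finitely many coordinates detect it, and these vanish on
  -- the remainder for large `n`.
  let D : Set E := (fun p : E × E => (1 / 2 : ℝ) • (p.1 - p.2)) '' (K ×ˢ K) ∩ {y | ε ≤ ‖y‖}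
  have hD : IsCompact D := ((hK.prod hK).image (by fun_prop)).inter_right
    (isClosed_le continuous_const continuous_norm)
  obtain ⟨t, ht⟩ := hD.elim_finite_subcover (fun k => {y | B.e k y ≠ 0})
    (fun k => isOpen_ne_fun (by fun_prop) continuous_const) (fun y hy => by
      by_contra hn
      simp only [Set.mem_iUnion, Set.mem_ofPred_eq, not_exists, not_not] at hn
      have : y = 0 := B.separates y 0 fun n => by rw [hn n, map_zero]
      have h2 : ε ≤ ‖y‖ := hy.2
      rw [this, norm_zero] at h2
      linarith)
  refine ⟨t.sup id + 1, fun n hn => ?_⟩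
  have hsub : {z | ε < ‖z - i (B.proj n z)‖} ⊆ Kᶜ ∪ B.reflection n ⁻¹' Kᶜ := by
    intro z hz
    by_contra hzK
    simp only [Set.mem_union, Set.mem_compl_iff, Set.mem_preimage, not_or, not_not] at hzK
    have hzD : z - i (B.proj n z) ∈ D := by
      refine ⟨⟨(z, B.reflection n z), hzK, ?_⟩, (show ε < _ from hz).le⟩
      simp only [CarmonaBasis.reflection_apply]
      module
    obtain ⟨k, hkt, hk⟩ := Set.mem_iUnion₂.1 (ht hzD)
    have hkn : k < n := lt_of_lt_of_le (Nat.lt_succ_of_le (Finset.le_sup (f := id) hkt)) hn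
    exact hk (by rw [map_sub, B.e_proj, if_pos hkn, sub_self])
  calc μ {z | ε < ‖z - i (B.proj n z)‖} ≤ μ Kᶜ + μ (B.reflection n ⁻¹' Kᶜ) :=
        (measure_mono hsub).trans (measure_union_le _ _)
    _ = μ Kᶜ + μ Kᶜ := by
        rw [← Measure.map_apply (by fun_prop) hK.measurableSet.compl,
          hW.map_eq_self _ fun l => B.norm_dualToH_comp_reflection l n]
    _ ≤ δ / 2 + δ / 2 := add_le_add hKμ hKμ
    _ = δ := ENNReal.add_halves δ

lemma gaussianReal_one_lt_abs_pos : 0 < gaussianReal 0 1 {y : ℝ | 1 < |y|} := by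
  rw [pos_iff_ne_zero]
  intro h
  have h0 : (volume : Measure ℝ) {y : ℝ | 1 < |y|} = 0 :=
    gaussianReal_absolutelyContinuous' 0 one_ne_zero h
  have : IsOpen {y : ℝ | 1 < |y|} := isOpen_lt continuous_const continuous_abs
  exact (this.measure_pos volume ⟨2, by norm_num⟩).ne' h0

/-- A functional which is small with large probability has small norm in `H`. -/
lemma norm_dualToH_le (hW : IsAbstractWienerSpace i μ) (l : StrongDual ℝ E) {ε : ℝ} (hε : 0 ≤ ε)
    (h : μ {z | ε < |l z|} < gaussianReal 0 1 {y : ℝ | 1 < |y|}) : ‖dualToH i l‖ ≤ ε := by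
  by_contra! hlt
  refine h.not_ge ?_
  have hmeas : ∀ a : ℝ, MeasurableSet {y : ℝ | a < |y|} := fun a =>
    measurableSet_lt measurable_const measurable_norm
  have h1 : μ {z | ε < |l z|} = μ.map l {y : ℝ | ε < |y|} :=
    (Measure.map_apply (by fun_prop) (hmeas ε)).symm
  -- The law of `l` is a standard normal dilated by its norm in `H`; if that norm exceeds `ε`, then
  -- `1 < |y|` implies that the dilated value exceeds `ε`.
  have h2 : gaussianReal 0 (‖dualToH i l‖₊ ^ 2) =
      (gaussianReal 0 1).map (‖dualToH i l‖ * ·) := by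
    rw [gaussianReal_map_const_mul, mul_zero, mul_one]
    congr 1
  rw [h1, hW.gaussian l, h2, Measure.map_apply (by fun_prop) (hmeas ε)]
  refine measure_mono fun y (hy : 1 < |y|) => ?_
  change ε < |‖dualToH i l‖ * y|
  rw [abs_mul, abs_norm]
  nlinarith

/-- With `l` norming the image of `h`, the functional `m = l ∘ (1 - P̃_n)` is dominated by `‖z -
P̃_n z‖`, hence small in measure and so of norm at most `ε` in `H`. The index `n` depends only on
the measure estimate, not on `h`. -/
lemma eventually_opNorm_le (hW : IsAbstractWienerSpace i μ) (B : CarmonaBasis i x)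
    {ε : ℝ} (hε : 0 < ε) :
    ∀ᶠ n in atTop, ‖i - (i.comp (B.proj n)).comp i‖ ≤ ε := by
  filter_upwards [(hW.tendsto_measure_lt_norm_sub_proj B hε).eventually
    (gt_mem_nhds gaussianReal_one_lt_abs_pos)] with n hn
  refine ContinuousLinearMap.opNorm_le_bound _ hε.le fun h => ?_
  obtain ⟨l, hl1, hl⟩ := exists_dual_vector'' ℝ ((i - (i.comp (B.proj n)).comp i) h)
  let m : StrongDual ℝ E := l - l.comp (i.comp (B.proj n))
  have hm : ‖dualToH i m‖ ≤ ε := by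
    refine hW.norm_dualToH_le m hε.le (lt_of_le_of_lt (measure_mono fun z hz => ?_) hn)
    have : |m z| ≤ ‖z - i (B.proj n z)‖ := by
      have : m z = l (z - i (B.proj n z)) := by simp [m]
      rw [this]
      simpa using l.le_of_opNorm_le hl1 (z - i (B.proj n z))
    exact lt_of_lt_of_le hz this
  have hmh : inner ℝ (dualToH i m) h = ‖(i - (i.comp (B.proj n)).comp i) h‖ := by
    rw [inner_dualToH]
    refine Eq.trans ?_ hl
    simp [m]
  rw [← hmh]
  exact (real_inner_le_norm _ _).trans (mul_le_mul_of_nonneg_right hm (norm_nonneg h))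

lemma exists_isAdmissible (hW : IsAbstractWienerSpace i μ) (B : CarmonaBasis i x) :
    ∃ ν : ℕ → ℕ, B.IsAdmissible μ ν := by
  -- `φ n` will be `ν (n + 1)`, whence the exponents `n + 1`; the condition `1 ≤ k` secures `ν 0 = 0
  -- < ν 1`.
  obtain ⟨φ, hφ, hφ'⟩ := extraction_forall_of_eventually (P := fun n k =>
    1 ≤ k ∧ ‖i - (i.comp (B.proj k)).comp i‖ ≤ (1 / 2 : ℝ) ^ (n + 1) ∧
      μ {z | (1 / 2 : ℝ) ^ (n + 1) < ‖z - i (B.proj k z)‖} ≤ (1 / 2 : ℝ≥0∞) ^ (n + 1)) fun n => by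
    have hp : (0 : ℝ) < (1 / 2 : ℝ) ^ (n + 1) := by positivity
    filter_upwards [eventually_ge_atTop 1, hW.eventually_opNorm_le B hp,
      (hW.tendsto_measure_lt_norm_sub_proj B hp).eventually (ge_mem_nhds
        (show 0 < (1 / 2 : ℝ≥0∞) ^ (n + 1) from ENNReal.pow_pos (by simp) _))] with k h1 h2 h3
    exact ⟨h1, h2, h3⟩
  refine ⟨fun n => Nat.casesOn n 0 φ, strictMono_nat_of_lt_succ fun n => ?_, rfl, fun n hn => ?_,
    fun n hn => ?_⟩
  · cases n with
    | zero => exact (hφ' 0).1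
    | succ n => exact hφ n.lt_succ_self
  · obtain ⟨n, rfl⟩ := Nat.exists_eq_succ_of_ne_zero (Nat.one_le_iff_ne_zero.1 hn)
    exact (hφ' n).2.1
  · obtain ⟨n, rfl⟩ := Nat.exists_eq_succ_of_ne_zero (Nat.one_le_iff_ne_zero.1 hn)
    exact (hφ' n).2.2

end IsAbstractWienerSpace

end Gaussian

/-! ### Series in `[0, ∞]`. -/

lemma tsum_mul_sq_le (f g : ℕ → ℝ≥0∞) :
    (∑' n, f n * g n) ^ 2 ≤ (∑' n, f n ^ 2) * ∑' n, g n ^ 2 := by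
  have h := ENNReal.lintegral_mul_le_Lp_mul_Lq Measure.count Real.HolderConjugate.two_two
    (measurable_of_countable f).aemeasurable (measurable_of_countable g).aemeasurable
  simp only [lintegral_count, Pi.mul_apply, ENNReal.rpow_two] at h
  refine (pow_le_pow_left₀ zero_le h 2).trans_eq ?_
  rw [mul_pow, ← ENNReal.rpow_natCast, ← ENNReal.rpow_natCast, ← ENNReal.rpow_mul,
    ← ENNReal.rpow_mul]
  norm_num

lemma two_rpow_half_sq (a : ℝ) : ((2 : ℝ≥0∞) ^ (a / 2)) ^ 2 = 2 ^ a := by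
  rw [← ENNReal.rpow_natCast, ← ENNReal.rpow_mul]
  norm_num

lemma two_rpow_neg_half_sq (n : ℕ) :
    ((2 : ℝ≥0∞) ^ (-(((n : ℝ) + 1) / 2))) ^ 2 = 2⁻¹ ^ (n + 1) := by
  rw [← neg_div, two_rpow_half_sq, ENNReal.rpow_neg, ← ENNReal.inv_pow, ← ENNReal.rpow_natCast]
  push_cast
  rfl

/-- Dominated convergence to zero for series in `[0, ∞]`. -/
lemma tendsto_tsum_zero_of_dominated {F : ℕ → ℕ → ℝ≥0∞} {a : ℕ → ℝ≥0∞} (ha : ∑' n, a n ≠ ∞)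
    (hF : ∀ m n, F m n ≤ a n) (h0 : ∀ n, ∀ᶠ m in atTop, F m n = 0) :
    Tendsto (fun m => ∑' n, F m n) atTop (𝓝 0) := by
  have h := tendsto_lintegral_of_dominated_convergence (μ := Measure.count) (F := F)
    (f := fun _ => 0) a (fun m => measurable_of_countable _)
    (fun m => Eventually.of_forall (hF m)) (by rwa [lintegral_count])
    (Eventually.of_forall fun n => tendsto_const_nhds.congr'
      ((h0 n).mono fun m hm => hm.symm))
  simpa only [lintegral_count, tsum_zero] using h

/-! ### Deterministic properties of `q_x` and of the space `E_x`. -/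

namespace CarmonaBasis

variable {H E : Type*} [NormedAddCommGroup H] [InnerProductSpace ℝ H] [CompleteSpace H]
  [NormedAddCommGroup E] [NormedSpace ℝ E] {i : H →L[ℝ] E} {x : E} (B : CarmonaBasis i x)
  {ν : ℕ → ℕ}

/-- The increment `Q̃_{n+1} - Q̃_n`, as an operator on `E`. -/
def incr (ν : ℕ → ℕ) (n : ℕ) : E →L[ℝ] E := i.comp (B.proj (ν (n + 1))) - i.comp (B.proj (ν n))

lemma incr_apply (ν : ℕ → ℕ) (n : ℕ) (z : E) :
    B.incr ν n z = i (B.proj (ν (n + 1)) z) - i (B.proj (ν n) z) := rfl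

lemma q_sq (ν : ℕ → ℕ) (z : E) :
    B.q ν z ^ 2 = (∑' n : ℕ, (2 : ℝ≥0∞) ^ n * ‖B.incr ν n z‖ₑ ^ 2) +
      (∑' n : ℕ, (2 : ℝ≥0∞) ^ (-(((n : ℝ) + 1) / 2)) * ‖B.e n z‖ₑ) ^ 2 := by
  rw [q, ← ENNReal.rpow_natCast, ← ENNReal.rpow_mul]
  norm_num [incr_apply]

lemma lowerSemicontinuous_q (ν : ℕ → ℕ) :
    LowerSemicontinuous fun z => B.q ν z := by
  have h1 : LowerSemicontinuous fun z : E =>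
      ∑' n : ℕ, (2 : ℝ≥0∞) ^ n * ‖i (B.proj (ν (n + 1)) z) - i (B.proj (ν n) z)‖ₑ ^ 2 :=
    lowerSemicontinuous_tsum fun n => (ENNReal.continuous_const_mul (by simp)).comp
      ((ENNReal.continuous_pow 2).comp (by fun_prop)) |>.lowerSemicontinuous
  have h2 : LowerSemicontinuous fun z : E =>
      ∑' n : ℕ, (2 : ℝ≥0∞) ^ (-(((n : ℝ) + 1) / 2)) * ‖B.e n z‖ₑ :=
    lowerSemicontinuous_tsum fun n => (ENNReal.continuous_const_mul
      (by simp [ENNReal.rpow_eq_top_iff])).comp (by fun_prop) |>.lowerSemicontinuous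
  exact ENNReal.continuous_rpow_const.comp_lowerSemicontinuous
    (h1.add ((ENNReal.continuous_pow 2).comp_lowerSemicontinuous h2
      fun a b hab => pow_le_pow_left₀ zero_le hab 2)) (ENNReal.monotone_rpow_of_nonneg (by norm_num))

/-- Cauchy-Schwarz against the weights `2^(-n/2)`; the prefactor is the geometric tail `∑_{n ≥ m}
2^(-n)`. -/
lemma tsum_incr_sq_le (ν : ℕ → ℕ) (z : E) (m : ℕ) :
    (∑' n, ‖B.incr ν (n + m) z‖ₑ) ^ 2 ≤ 2 * 2⁻¹ ^ m * B.q ν z ^ 2 := by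
  have h1 : ∀ n : ℕ, (2 : ℝ≥0∞) ^ (-(((n + m : ℕ) : ℝ)) / 2) * 2 ^ (((n + m : ℕ) : ℝ) / 2) = 1 :=
    fun n => by
      rw [← ENNReal.rpow_add _ _ (by simp) (by simp), neg_div, neg_add_cancel, ENNReal.rpow_zero]
  have h2 : ∀ n : ℕ, ‖B.incr ν (n + m) z‖ₑ = (2 : ℝ≥0∞) ^ (-(((n + m : ℕ) : ℝ)) / 2) *
      (2 ^ (((n + m : ℕ) : ℝ) / 2) * ‖B.incr ν (n + m) z‖ₑ) := fun n => by
    rw [← mul_assoc, h1, one_mul]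
  rw [tsum_congr h2]
  refine (tsum_mul_sq_le _ _).trans (mul_le_mul' (le_of_eq ?_) ?_)
  · simp only [two_rpow_half_sq, ENNReal.rpow_neg, ENNReal.rpow_natCast, ENNReal.inv_pow]
    simp only [pow_add, ENNReal.tsum_mul_right]
    rw [ENNReal.tsum_geometric_two]
  · simp only [mul_pow, two_rpow_half_sq, ENNReal.rpow_natCast]
    rw [q_sq]
    refine le_add_right ?_
    exact ENNReal.tsum_comp_le_tsum_of_injective (add_left_injective m)
      fun n => (2 : ℝ≥0∞) ^ n * ‖B.incr ν n z‖ₑ ^ 2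

lemma sum_incr (h0 : ν 0 = 0) (z : E) (n : ℕ) :
    ∑ k ∈ Finset.range n, B.incr ν k z = i (B.proj (ν n) z) := by
  simp only [incr_apply]
  rw [Finset.sum_range_sub (fun k => i (B.proj (ν k) z)), h0]
  simp [proj_apply]

/-- Finite `q_x` makes the telescoping series absolutely convergent in `E`. Its sum is `z` because
each coordinate of the partial sums is eventually that of `z`, and the coordinates separate points.
-/
lemma hasSum_incr [CompleteSpace E] (hν : StrictMono ν) (h0 : ν 0 = 0) {z : E}
    (hz : B.q ν z ≠ ∞) : HasSum (fun n => B.incr ν n z) z := by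
  have hfin : ∑' n, ‖B.incr ν n z‖ₑ ≠ ∞ := by
    intro h
    have := B.tsum_incr_sq_le ν z 0
    simp only [add_zero, h] at this
    refine this.not_gt ?_
    simpa using ENNReal.mul_lt_top (by simp) (ENNReal.pow_lt_top hz.lt_top)
  have hs : Summable fun n => B.incr ν n z := Summable.of_norm (by
    simpa [← summable_norm_iff] using ENNReal.summable_toReal hfin)
  have ht := hs.hasSum.tendsto_sum_nat
  simp only [B.sum_incr h0] at ht
  suffices h : ∑' n, B.incr ν n z = z by
    have := hs.hasSum
    rwa [h] at this
  refine B.separates _ _ fun k => ?_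
  refine tendsto_nhds_unique (((B.e k).continuous.tendsto _).comp ht)
    (tendsto_const_nhds.congr' ?_)
  filter_upwards [eventually_gt_atTop k] with n hn
  simp only [Function.comp_apply]
  rw [e_proj, if_pos (hn.trans_le (hν.id_le n))]

/-- The case `m = 0` is the comparison of norms with constant `√2`; the decay in `m` makes the
inclusion of `E_x` a norm limit of finite rank operators. -/
lemma enorm_sub_proj_sq_le [CompleteSpace E] (hν : StrictMono ν) (h0 : ν 0 = 0) {z : E}
    (hz : B.q ν z ≠ ∞) (m : ℕ) :
    ‖z - i (B.proj (ν m) z)‖ₑ ^ 2 ≤ 2 * 2⁻¹ ^ m * B.q ν z ^ 2 := by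
  refine le_trans (pow_le_pow_left₀ zero_le ?_ 2) (B.tsum_incr_sq_le ν z m)
  have h := (hasSum_nat_add_iff' m).2 (B.hasSum_incr hν h0 hz)
  rw [B.sum_incr h0] at h
  rw [← h.tsum_eq]
  exact enorm_tsum_le_tsum_enorm

lemma enorm_le_q [CompleteSpace E] (hν : StrictMono ν) (h0 : ν 0 = 0) (z : E) :
    ‖z‖ₑ ≤ ENNReal.ofReal √2 * B.q ν z := by
  by_cases hz : B.q ν z = ∞
  · rw [hz, ENNReal.mul_top (by simp)]
    exact le_top
  · have h := B.enorm_sub_proj_sq_le hν h0 hz 0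
    rw [h0] at h
    simp only [proj_apply, Finset.range_zero, Finset.sum_empty, map_zero, sub_zero, pow_zero,
      mul_one] at h
    rw [← ENNReal.pow_le_pow_left_iff two_ne_zero, mul_pow,
      ← ENNReal.ofReal_pow (by positivity), Real.sq_sqrt (by norm_num)]
    simpa using h

lemma norm_incl_le [CompleteSpace E] (hν : StrictMono ν) (h0 : ν 0 = 0) (z : B.Space ν) :
    ‖B.incl ν z‖ ≤ √2 * ‖z‖ := by
  have h := ENNReal.toReal_mono (ENNReal.mul_ne_top (by simp) (B.q_incl_ne_top ν z))
    (B.enorm_le_q hν h0 (B.incl ν z))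
  rwa [ENNReal.toReal_mul, ENNReal.toReal_ofReal (by positivity), toReal_enorm, ← norm_eq] at h

/-- The continuous inclusion `E_x ⊂ E`. -/
def inclL [CompleteSpace E] (hν : StrictMono ν) (h0 : ν 0 = 0) : B.Space ν →L[ℝ] E :=
  (B.incl ν).mkContinuous √2 (B.norm_incl_le hν h0)

lemma inclL_apply [CompleteSpace E] (hν : StrictMono ν) (h0 : ν 0 = 0) (z : B.Space ν) :
    B.inclL hν h0 z = B.incl ν z := rfl

lemma incl_injective (ν : ℕ → ℕ) : Function.Injective (B.incl ν) :=
  Submodule.subtype_injective (B.subspace ν)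

lemma exists_incl_eq {z : E} (hz : B.q ν z ≠ ∞) : ∃ w : B.Space ν, B.incl ν w = z :=
  ⟨(⟨z, hz.lt_top⟩ : B.subspace ν), rfl⟩

/-- A `q_x`-Cauchy sequence converges in `E`, and lower semicontinuity of `q_x` on `E` carries the
Cauchy estimates over to the limit. -/
lemma completeSpace [CompleteSpace E] (hν : StrictMono ν) (h0 : ν 0 = 0) :
    CompleteSpace (B.Space ν) := by
  refine Metric.complete_of_cauchySeq_tendsto fun u hu => ?_
  obtain ⟨z, hz⟩ := cauchySeq_tendsto_of_complete
    ((B.inclL hν h0).uniformContinuous.comp_cauchySeq hu)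
  simp only [Function.comp_def, inclL_apply] at hz
  have key : ∀ ε > 0, ∃ N, ∀ n ≥ N, B.q ν (B.incl ν (u n) - z) ≤ ENNReal.ofReal ε := by
    intro ε hε
    obtain ⟨N, hN⟩ := Metric.cauchySeq_iff.1 hu ε hε
    refine ⟨N, fun n hn => ?_⟩
    refine ((B.lowerSemicontinuous_q ν).isClosed_preimage
      (ENNReal.ofReal ε)).mem_of_tendsto (tendsto_const_nhds.sub hz) ?_
    filter_upwards [eventually_ge_atTop N] with m hm
    have h1 := (hN n hn m hm).le
    rw [dist_eq_norm, norm_eq, map_sub] at h1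
    refine (ENNReal.le_ofReal_iff_toReal_le ?_ hε.le).2 h1
    rw [← map_sub]
    exact B.q_incl_ne_top ν _
  obtain ⟨N, hN⟩ := key 1 one_pos
  obtain ⟨w, rfl⟩ : ∃ w : B.Space ν, B.incl ν w = z := by
    obtain ⟨v, hv⟩ := B.exists_incl_eq (ne_top_of_le_ne_top ENNReal.ofReal_ne_top (hN N le_rfl))
    exact ⟨u N - v, by rw [map_sub, hv, sub_sub_cancel]⟩
  refine ⟨w, Metric.tendsto_atTop.2 fun ε hε => ?_⟩
  obtain ⟨N, hN⟩ := key (ε / 2) (half_pos hε)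
  refine ⟨N, fun n hn => lt_of_le_of_lt ?_ (half_lt_self hε)⟩
  rw [dist_eq_norm, norm_eq, map_sub]
  exact ENNReal.toReal_le_of_le_ofReal (half_pos hε).le (hN n hn)

lemma isCompactOperator_proj (n : ℕ) : IsCompactOperator (B.proj n) := by
  have h : B.proj n ∈ compactOperator (RingHom.id ℝ) E H := by
    refine Submodule.sum_mem _ fun k _ => ?_
    exact (isCompactOperator_of_locallyCompactSpace_rng
      (ContinuousLinearMap.toSpanSingleton ℝ (dualToH i (B.e k)))).comp_clm (B.e k)
  exact h

lemma isCompactOperator_incl [CompleteSpace E] (hν : StrictMono ν) (h0 : ν 0 = 0) :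
    IsCompactOperator (B.incl ν) := by
  have hlim : Tendsto (fun m => (i.comp (B.proj (ν m))).comp (B.inclL hν h0)) atTop
      (𝓝 (B.inclL hν h0)) := by
    rw [tendsto_iff_norm_sub_tendsto_zero]
    have hs : Tendsto (fun m : ℕ => √(2 * (1 / 2 : ℝ) ^ m)) atTop (𝓝 0) := by
      have := ((tendsto_pow_atTop_nhds_zero_of_lt_one (by norm_num : (0 : ℝ) ≤ 1 / 2)
        (by norm_num)).const_mul 2).sqrt
      simpa using this
    refine squeeze_zero (fun _ => norm_nonneg _) (fun m => ?_) hs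
    refine ContinuousLinearMap.opNorm_le_bound _ (Real.sqrt_nonneg _) fun z => ?_
    have h := ENNReal.toReal_mono (by
      exact ENNReal.mul_ne_top (by simp [ENNReal.mul_eq_top])
        (ENNReal.pow_ne_top (B.q_incl_ne_top ν z)))
      (B.enorm_sub_proj_sq_le hν h0 (B.q_incl_ne_top ν z) m)
    rw [ENNReal.toReal_mul, ENNReal.toReal_mul, ENNReal.toReal_pow, ENNReal.toReal_pow,
      ENNReal.toReal_pow, toReal_enorm, ← norm_eq] at h
    have h2 : ‖((i.comp (B.proj (ν m))).comp (B.inclL hν h0) - B.inclL hν h0) z‖ =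
        ‖B.incl ν z - i (B.proj (ν m) (B.incl ν z))‖ := by
      rw [← norm_neg]
      simp [inclL_apply]
    rw [h2]
    refine (Real.le_sqrt (norm_nonneg _) (by positivity)).2 h |>.trans_eq ?_
    simp
  exact isCompactOperator_of_tendsto hlim (Eventually.of_forall fun m =>
    ((B.isCompactOperator_proj (ν m)).clm_comp i).comp_clm (B.inclL hν h0))

/-- Since the projections are nested, subtracting `Q̃_m z` deletes the first `m` increments and
leaves the others intact; this allows dominated convergence below. -/
lemma incr_sub_proj (hν : StrictMono ν) (m n : ℕ) (z : E) :
    B.incr ν n (z - i (B.proj (ν m) z)) = if n < m then 0 else B.incr ν n z := by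
  simp only [incr_apply, map_sub, proj_proj]
  split_ifs with h
  · rw [min_eq_left (hν.monotone h), min_eq_left (hν.monotone h.le)]
    abel
  · rw [not_lt] at h
    rw [min_eq_right (hν.monotone (h.trans n.le_succ)), min_eq_right (hν.monotone h)]
    abel

/-- `Q̃_m z` converges to `z` in the norm of `E_x`. -/
lemma tendsto_q_sub_proj (hν : StrictMono ν) {z : E} (hz : B.q ν z ≠ ∞) :
    Tendsto (fun m => B.q ν (z - i (B.proj (ν m) z))) atTop (𝓝 0) := by
  have hz2 : B.q ν z ^ 2 ≠ ∞ := ENNReal.pow_ne_top hz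
  rw [q_sq, ENNReal.add_ne_top] at hz2
  have h1 : Tendsto (fun m => ∑' n : ℕ, (2 : ℝ≥0∞) ^ n *
      ‖B.incr ν n (z - i (B.proj (ν m) z))‖ₑ ^ 2) atTop (𝓝 0) := by
    refine tendsto_tsum_zero_of_dominated hz2.1 (fun m n => ?_) fun n => ?_
    · rw [incr_sub_proj B hν]
      split_ifs <;> simp
    · filter_upwards [eventually_gt_atTop n] with m hm
      rw [incr_sub_proj B hν, if_pos hm]
      simp
  have h2 : Tendsto (fun m => ∑' n : ℕ, (2 : ℝ≥0∞) ^ (-(((n : ℝ) + 1) / 2)) *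
      ‖B.e n (z - i (B.proj (ν m) z))‖ₑ) atTop (𝓝 0) := by
    refine tendsto_tsum_zero_of_dominated (fun h => hz2.2 (by rw [h]; simp)) (fun m n => ?_)
      fun n => ?_
    · rw [map_sub, e_proj]
      split_ifs <;> simp
    · filter_upwards [eventually_gt_atTop n] with m hm
      rw [map_sub, e_proj, if_pos (hm.trans_le (hν.id_le m))]
      simp
  have h3 := (ENNReal.continuous_rpow_const (y := 1 / 2)).tendsto _ |>.comp
    (h1.add ((ENNReal.continuous_pow 2).tendsto _ |>.comp h2))
  simpa [q, incr_apply, Function.comp_def] using h3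

/-- The increment of index `n ≥ 1` is `1 - Q̃_n` applied to a vector of norm at most `|h|`, hence at
most `2^(-n) |h|`; the weighted squares sum to at most `|h|²`. The increment of index `0`
contributes `‖i‖² |h|²`, and the coordinate term another `|h|²` by Cauchy-Schwarz and Bessel. -/
lemma q_apply_sq_le [MeasurableSpace E] {μ : Measure E}
    (hν : B.IsAdmissible μ ν) (h : H) :
    B.q ν (i h) ^ 2 ≤ (2 + ‖i‖ₑ ^ 2) * ‖h‖ₑ ^ 2 := by
  have hpos : ∀ n, ‖B.incr ν (n + 1) (i h)‖ₑ ≤ 2⁻¹ ^ (n + 1) * ‖h‖ₑ := by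
    intro n
    set g := B.proj (ν (n + 1 + 1)) (i h) - B.proj (ν (n + 1)) (i h) with hg
    have hgi : B.incr ν (n + 1) (i h) = (i - (i.comp (B.proj (ν (n + 1)))).comp i) g := by
      have : B.proj (ν (n + 1)) (i g) = 0 := by
        rw [hg, map_sub, map_sub, proj_proj, proj_proj,
          min_eq_left (hν.strictMono.monotone (Nat.le_succ _)), min_self, sub_self]
      rw [sub_apply, ContinuousLinearMap.comp_apply, ContinuousLinearMap.comp_apply, this,
        map_zero, sub_zero, hg, map_sub, incr_apply]
    have hle : ‖B.incr ν (n + 1) (i h)‖ ≤ (1 / 2) ^ (n + 1) * ‖h‖ := by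
      rw [hgi]
      refine (ContinuousLinearMap.le_of_opNorm_le _ (hν.opNorm_le (n + 1) (by omega)) g).trans ?_
      exact mul_le_mul_of_nonneg_left
        (B.norm_proj_sub_proj_le (hν.strictMono.monotone (Nat.le_succ _)) h) (by positivity)
    have := ENNReal.ofReal_le_ofReal hle
    rw [ofReal_norm, ENNReal.ofReal_mul (by positivity), ofReal_norm,
      ENNReal.ofReal_pow (by positivity)] at this
    simpa [ENNReal.ofReal_inv_of_pos] using this
  have hzero : ‖B.incr ν 0 (i h)‖ₑ ≤ ‖i‖ₑ * ‖h‖ₑ := by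
    have hle : ‖B.incr ν 0 (i h)‖ ≤ ‖i‖ * ‖h‖ := by
      rw [incr_apply, ← map_sub]
      exact (i.le_opNorm _).trans (mul_le_mul_of_nonneg_left
        (B.norm_proj_sub_proj_le (hν.strictMono.monotone (Nat.le_succ _)) h) (norm_nonneg i))
    have := ENNReal.ofReal_le_ofReal hle
    rwa [ENNReal.ofReal_mul (norm_nonneg i), ofReal_norm, ofReal_norm, ofReal_norm] at this
  have hA : ∑' n : ℕ, (2 : ℝ≥0∞) ^ n * ‖B.incr ν n (i h)‖ₑ ^ 2 ≤ (1 + ‖i‖ₑ ^ 2) * ‖h‖ₑ ^ 2 := by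
    rw [tsum_eq_zero_add' ENNReal.summable, add_mul, add_comm]
    refine add_le_add ?_ (by simpa [mul_pow] using pow_le_pow_left₀ zero_le hzero 2)
    have hg : ∑' n : ℕ, (2⁻¹ : ℝ≥0∞) ^ (n + 1) = 1 := by
      rw [ENNReal.tsum_geometric_add_one, ENNReal.one_sub_inv_two, inv_inv,
        ENNReal.inv_mul_cancel (by simp) (by simp)]
    rw [← hg, ← ENNReal.tsum_mul_right]
    refine ENNReal.tsum_le_tsum fun n => ?_
    calc (2 : ℝ≥0∞) ^ (n + 1) * ‖B.incr ν (n + 1) (i h)‖ₑ ^ 2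
        ≤ 2 ^ (n + 1) * (2⁻¹ ^ (n + 1) * ‖h‖ₑ) ^ 2 := by gcongr; exact hpos n
      _ = (2 * 2⁻¹) ^ (n + 1) * (2⁻¹ ^ (n + 1) * ‖h‖ₑ ^ 2) := by ring
      _ = 2⁻¹ ^ (n + 1) * ‖h‖ₑ ^ 2 := by
        rw [ENNReal.mul_inv_cancel (by simp) (by simp), one_pow, one_mul]
  have hS : (∑' n : ℕ, (2 : ℝ≥0∞) ^ (-(((n : ℝ) + 1) / 2)) * ‖B.e n (i h)‖ₑ) ^ 2 ≤ ‖h‖ₑ ^ 2 := by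
    refine (tsum_mul_sq_le _ _).trans ?_
    simp only [two_rpow_neg_half_sq]
    rw [ENNReal.tsum_geometric_add_one, ENNReal.one_sub_inv_two, inv_inv,
        ENNReal.inv_mul_cancel (by simp) (by simp), one_mul]
    have hb := B.orthonormal.tsum_inner_products_le h
    simp only [inner_dualToH] at hb
    have hs := B.orthonormal.inner_products_summable h
    simp only [inner_dualToH] at hs
    have := ENNReal.ofReal_le_ofReal hb
    rw [ENNReal.ofReal_tsum_of_nonneg (fun _ => by positivity) hs] at this
    simpa only [ENNReal.ofReal_pow (norm_nonneg _), ofReal_norm] using this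
  rw [q_sq]
  refine (add_le_add hA hS).trans_eq ?_
  ring

lemma q_apply_le [MeasurableSpace E] {μ : Measure E} (hν : B.IsAdmissible μ ν) (h : H) :
    B.q ν (i h) ≤ ENNReal.ofReal (√(2 + ‖i‖ ^ 2) * ‖h‖) := by
  rw [← ENNReal.pow_le_pow_left_iff two_ne_zero]
  refine (B.q_apply_sq_le hν h).trans_eq ?_
  rw [← ENNReal.ofReal_pow (by positivity), mul_pow, Real.sq_sqrt (by positivity),
    ENNReal.ofReal_mul (by positivity), ENNReal.ofReal_add (by norm_num) (by positivity),
    ENNReal.ofReal_pow (norm_nonneg _), ENNReal.ofReal_pow (norm_nonneg _), ofReal_norm,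
    ofReal_norm]
  simp

lemma q_apply_le_of_norm_le_one [MeasurableSpace E] {μ : Measure E} (hν : B.IsAdmissible μ ν)
    (hi : ‖i‖ ≤ 1) (h : H) : B.q ν (i h) ≤ ENNReal.ofReal (√3 * ‖h‖) := by
  refine (B.q_apply_le hν h).trans (ENNReal.ofReal_le_ofReal ?_)
  gcongr
  nlinarith [norm_nonneg i]

/-- The embedding `H ⊂ E_x`. -/
lemma exists_embedding [MeasurableSpace E] {μ : Measure E} (hν : B.IsAdmissible μ ν) :
    ∃ j : H →L[ℝ] B.Space ν, ∀ h, B.incl ν (j h) = i h := by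
  let j : H →ₗ[ℝ] B.Space ν := (i : H →ₗ[ℝ] E).codRestrict (B.subspace ν)
    fun h => (B.q_apply_le hν h).trans_lt ENNReal.ofReal_lt_top
  exact ⟨j.mkContinuous √(2 + ‖i‖ ^ 2) fun h =>
    ENNReal.toReal_le_of_le_ofReal (by positivity) (B.q_apply_le hν h), fun h => rfl⟩

lemma tendsto_embedding_proj (hν : StrictMono ν) {j : H →L[ℝ] B.Space ν}
    (hj : ∀ h, B.incl ν (j h) = i h) (z : B.Space ν) :
    Tendsto (fun m => j (B.proj (ν m) (B.incl ν z))) atTop (𝓝 z) := by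
  rw [tendsto_iff_norm_sub_tendsto_zero]
  have h := (ENNReal.tendsto_toReal ENNReal.zero_ne_top).comp
    (B.tendsto_q_sub_proj hν (B.q_incl_ne_top ν z))
  refine h.congr fun m => ?_
  rw [← norm_neg, neg_sub, norm_eq, map_sub, hj]
  rfl

end CarmonaBasis

/-! ### Uniform second moments from Fernique's theorem. -/

/-- All centered Gaussian measures which give mass `3/4` to the ball of radius `a` have second
moment bounded by a universal multiple of `a ^ 2`. -/
lemma exists_lintegral_enorm_sq_le (E : Type*) [NormedAddCommGroup E] [NormedSpace ℝ E]
    [MeasurableSpace E] [BorelSpace E] [SecondCountableTopology E] [CompleteSpace E] :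
    ∃ C : ℝ≥0∞, C ≠ ∞ ∧ ∀ (ρ : Measure E) [IsGaussian ρ], (∀ l : StrongDual ℝ E, ρ[l] = 0) →
      ∀ a : ℝ, 0 < a → 3 / 4 ≤ ρ {z | ‖z‖ ≤ a} →
        ∫⁻ z, ‖z‖ₑ ^ 2 ∂ρ ≤ C * ENNReal.ofReal a ^ 2 := by
  have h34 : (2 : ℝ≥0∞)⁻¹ < 3 / 4 := by
    rw [← ENNReal.toReal_lt_toReal (by simp) (by finiteness)]
    norm_num
  have h34' : (3 / 4 : ℝ≥0∞) < 1 := by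
    rw [← ENNReal.toReal_lt_toReal (by finiteness) (by simp)]
    norm_num
  -- Both `K` and `L` depend only on the level `3 / 4`, which is what makes `C` independent of `ρ`
  -- and `a`.
  set K := Fernique.logRatio (3 / 4) with hK
  have hKpos : 0 < K := Fernique.logRatio_pos h34 h34'
  set L : ℝ≥0∞ := ENNReal.ofReal (Real.exp K) + ∑' n : ℕ, ENNReal.ofReal (Real.exp
    (-2⁻¹ * Real.log ((3 / 4 : ℝ≥0∞) / (1 - 3 / 4)).toReal * 2 ^ n)) with hL
  have hLtop : L ≠ ∞ := by
    refine ENNReal.add_ne_top.2 ⟨ENNReal.ofReal_ne_top, ?_⟩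
    refine (Summable.tsum_ofReal_lt_top <| Real.summable_exp_nat_mul_of_ge ?_
      (fun i ↦ mod_cast (Nat.lt_pow_self (by simp)).le)).ne
    refine mul_neg_of_neg_of_pos (by simp) (Real.log_pos ?_)
    rw [ENNReal.toReal_div, ENNReal.toReal_sub_of_le h34'.le (by simp)]
    norm_num
  refine ⟨ENNReal.ofReal K⁻¹ * L, ENNReal.mul_ne_top ENNReal.ofReal_ne_top hLtop,
    fun ρ _ hρ a ha h => ?_⟩
  have hint := lintegral_exp_mul_sq_norm_le_of_map_rotation_eq_self
    (IsGaussian.map_rotation_eq_self_of_forall_strongDual_eq_zero hρ _) h h34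
  calc ∫⁻ z, ‖z‖ₑ ^ 2 ∂ρ
      ≤ ∫⁻ z, ENNReal.ofReal (K⁻¹ * a ^ 2) *
          ENNReal.ofReal (Real.exp (K * a⁻¹ ^ 2 * ‖z‖ ^ 2)) ∂ρ := by
        refine lintegral_mono fun z => ?_
        rw [← ENNReal.ofReal_mul (by positivity), ← ofReal_norm,
          ← ENNReal.ofReal_pow (norm_nonneg _)]
        refine ENNReal.ofReal_le_ofReal ?_
        have h1 : K * a⁻¹ ^ 2 * ‖z‖ ^ 2 ≤ Real.exp (K * a⁻¹ ^ 2 * ‖z‖ ^ 2) :=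
          (lt_add_one _).le.trans (Real.add_one_le_exp _)
        calc ‖z‖ ^ 2 = K⁻¹ * a ^ 2 * (K * a⁻¹ ^ 2 * ‖z‖ ^ 2) := by field_simp
          _ ≤ _ := mul_le_mul_of_nonneg_left h1 (by positivity)
    _ = ENNReal.ofReal (K⁻¹ * a ^ 2) *
          ∫⁻ z, ENNReal.ofReal (Real.exp (K * a⁻¹ ^ 2 * ‖z‖ ^ 2)) ∂ρ :=
        lintegral_const_mul _ (by fun_prop)
    _ ≤ ENNReal.ofReal (K⁻¹ * a ^ 2) * L := by gcongr
    _ = ENNReal.ofReal K⁻¹ * L * ENNReal.ofReal a ^ 2 := by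
        rw [ENNReal.ofReal_mul (by positivity), ENNReal.ofReal_pow ha.le]
        ring

namespace CarmonaBasis

lemma IsAdmissible.measure_lt_norm_incr_le {H E : Type*} [NormedAddCommGroup H]
    [InnerProductSpace ℝ H] [CompleteSpace H] [NormedAddCommGroup E] [NormedSpace ℝ E]
    [MeasurableSpace E] {i : H →L[ℝ] E} {μ : Measure E} {x : E} {B : CarmonaBasis i x}
    {ν : ℕ → ℕ} (hν : B.IsAdmissible μ ν) {n : ℕ} (hn : 1 ≤ n) :
    μ {z | 2 * (1 / 2 : ℝ) ^ n < ‖B.incr ν n z‖} ≤ 2 * (1 / 2) ^ n := by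
  have hsub : {z | 2 * (1 / 2 : ℝ) ^ n < ‖B.incr ν n z‖} ⊆
      {z | (1 / 2 : ℝ) ^ (n + 1) < ‖z - i (B.proj (ν (n + 1)) z)‖} ∪
        {z | (1 / 2 : ℝ) ^ n < ‖z - i (B.proj (ν n) z)‖} := by
    intro z (hz : 2 * (1 / 2 : ℝ) ^ n < ‖B.incr ν n z‖)
    by_contra hcon
    simp only [Set.mem_union, Set.mem_ofPred_eq, not_or, not_lt] at hcon
    have h1 : B.incr ν n z = (z - i (B.proj (ν n) z)) - (z - i (B.proj (ν (n + 1)) z)) := by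
      rw [CarmonaBasis.incr_apply]; abel
    have h2 := norm_sub_le (z - i (B.proj (ν n) z)) (z - i (B.proj (ν (n + 1)) z))
    rw [← h1] at h2
    have h3 : (1 / 2 : ℝ) ^ (n + 1) ≤ (1 / 2) ^ n :=
      pow_le_pow_of_le_one (by norm_num) (by norm_num) n.le_succ
    linarith [hcon.1, hcon.2]
  refine (measure_mono hsub).trans ((measure_union_le _ _).trans ?_)
  rw [two_mul]
  refine add_le_add ((hν.measure_le (n + 1) (by omega)).trans ?_) (hν.measure_le n hn)
  exact pow_le_pow_of_le_one zero_le (by simp) n.le_succ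

end CarmonaBasis

/-! ### Square integrability of `q_x` and the Wiener space `(E_x, H, μ)`. -/

namespace IsAbstractWienerSpace

variable {H E : Type*} [NormedAddCommGroup H] [InnerProductSpace ℝ H] [CompleteSpace H]
  [NormedAddCommGroup E] [NormedSpace ℝ E] [MeasurableSpace E] [BorelSpace E]
  {i : H →L[ℝ] E} {μ : Measure E} {x : E} {B : CarmonaBasis i x} {ν : ℕ → ℕ}

lemma measurable_q (B : CarmonaBasis i x) (ν : ℕ → ℕ) : Measurable (B.q ν) :=
  (B.lowerSemicontinuous_q ν).measurable

/-- From index `3` on, the ball of radius `2 * 2^(-n)` carries mass at least `1 - 2 * 2^(-3) = 3/4`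
under the centered Gaussian law of the increment. The uniform Fernique bound gives second moments at
most `4 C 4^(-n)`, summable against `2^n`; the first three terms are merely finite. -/
lemma tsum_lintegral_incr_ne_top (hW : IsAbstractWienerSpace i μ) (hν : B.IsAdmissible μ ν) :
    ∑' n : ℕ, (2 : ℝ≥0∞) ^ n * ∫⁻ z, ‖B.incr ν n z‖ₑ ^ 2 ∂μ ≠ ∞ := by
  have := hW.isGaussian
  have := hW.secondCountable
  have := hW.complete
  have hmap : ∀ n, ∫⁻ z, ‖B.incr ν n z‖ₑ ^ 2 ∂μ = ∫⁻ y, ‖y‖ₑ ^ 2 ∂(μ.map (B.incr ν n)) :=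
    fun n => by rw [lintegral_map (by fun_prop) (by fun_prop)]
  obtain ⟨C, hC, hbound⟩ := exists_lintegral_enorm_sq_le E
  have hfin : ∀ n, ∫⁻ z, ‖B.incr ν n z‖ₑ ^ 2 ∂μ ≠ ∞ := fun n => by
    have h := (IsGaussian.memLp_two_id (μ := μ.map (B.incr ν n))).2
    rw [eLpNorm_lt_top_iff_lintegral_rpow_enorm_lt_top (by simp) (by simp)] at h
    rw [hmap]
    simpa using h.ne
  have htail : ∀ n, (2 : ℝ≥0∞) ^ (n + 3) * ∫⁻ z, ‖B.incr ν (n + 3) z‖ₑ ^ 2 ∂μ ≤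
      (4 * C) * 2⁻¹ ^ (n + 3) := fun n => by
    have hm : μ.map (B.incr ν (n + 3)) {z | 2 * (1 / 2 : ℝ) ^ (n + 3) < ‖z‖} ≤ 1 / 4 := by
      rw [Measure.map_apply (by fun_prop) (measurableSet_lt measurable_const measurable_norm)]
      refine (hν.measure_lt_norm_incr_le (n := n + 3) (by omega)).trans ?_
      calc (2 : ℝ≥0∞) * (1 / 2) ^ (n + 3) ≤ 2 * (1 / 2) ^ 3 := by
            gcongr 2 * ?_
            exact pow_le_pow_of_le_one zero_le (by simp) (by omega)
        _ = 1 / 4 := by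
            rw [← ENNReal.toReal_eq_toReal_iff' (by finiteness) (by finiteness)]
            norm_num
    have hc : 3 / 4 ≤ μ.map (B.incr ν (n + 3)) {z | ‖z‖ ≤ 2 * (1 / 2 : ℝ) ^ (n + 3)} := by
      have hcompl : {z : E | ‖z‖ ≤ 2 * (1 / 2 : ℝ) ^ (n + 3)} =
          {z | 2 * (1 / 2 : ℝ) ^ (n + 3) < ‖z‖}ᶜ := by ext; simp
      rw [hcompl, prob_compl_eq_one_sub (measurableSet_lt measurable_const measurable_norm)]
      refine le_trans ?_ (tsub_le_tsub_left hm 1)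
      refine le_of_eq ?_
      rw [← ENNReal.toReal_eq_toReal_iff' (by finiteness) (by finiteness),
        ENNReal.toReal_sub_of_le (by simp) (by simp)]
      norm_num
    have h := hbound (μ.map (B.incr ν (n + 3))) (fun l => by
      rw [integral_map (by fun_prop) (by fun_prop)]
      exact hW.integral_dual_eq_zero (l.comp (B.incr ν (n + 3)))) _ (by positivity) hc
    rw [hmap]
    calc (2 : ℝ≥0∞) ^ (n + 3) * ∫⁻ y, ‖y‖ₑ ^ 2 ∂(μ.map (B.incr ν (n + 3)))
        ≤ 2 ^ (n + 3) * (C * ENNReal.ofReal (2 * (1 / 2 : ℝ) ^ (n + 3)) ^ 2) := by gcongr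
      _ = 2 ^ (n + 3) * (C * (2 * 2⁻¹ ^ (n + 3)) ^ 2) := by
          rw [ENNReal.ofReal_mul (by norm_num), ENNReal.ofReal_pow (by norm_num), one_div,
            ENNReal.ofReal_inv_of_pos (by norm_num)]
          simp
      _ = (4 * C) * 2⁻¹ ^ (n + 3) * (2 * 2⁻¹) ^ (n + 3) := by ring
      _ = (4 * C) * 2⁻¹ ^ (n + 3) := by
          rw [ENNReal.mul_inv_cancel (by simp) (by simp), one_pow, mul_one]
  rw [← Summable.sum_add_tsum_nat_add' (k := 3) ENNReal.summable]
  refine ENNReal.add_ne_top.2 ⟨ENNReal.sum_ne_top.2 fun n _ =>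
    ENNReal.mul_ne_top (by simp) (hfin n), ne_top_of_le_ne_top ?_ (ENNReal.tsum_le_tsum htail)⟩
  simp only [pow_add, ENNReal.tsum_mul_left, ENNReal.tsum_mul_right, ENNReal.tsum_geometric_two]
  finiteness

lemma tsum_two_rpow_ne_top : ∑' n : ℕ, (2 : ℝ≥0∞) ^ (-(((n : ℝ) + 1) / 2)) ≠ ∞ := by
  have h : ∀ n : ℕ, (2 : ℝ≥0∞) ^ (-(((n : ℝ) + 1) / 2)) = ((2 : ℝ≥0∞) ^ (-(1 / 2 : ℝ))) ^ (n + 1) :=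
    fun n => by
      rw [← ENNReal.rpow_natCast, ← ENNReal.rpow_mul]
      congr 1
      push_cast
      ring
  rw [tsum_congr h, ENNReal.tsum_geometric_add_one]
  have hlt : (2 : ℝ≥0∞) ^ (-(1 / 2 : ℝ)) < 1 :=
    ENNReal.rpow_lt_one_of_one_lt_of_neg (by norm_num) (by norm_num)
  refine ENNReal.mul_ne_top (hlt.trans ENNReal.one_lt_top).ne (ENNReal.inv_ne_top.2 ?_)
  exact (tsub_pos_of_lt hlt).ne'

lemma lintegral_e_sq (hW : IsAbstractWienerSpace i μ) (B : CarmonaBasis i x) (n : ℕ) :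
    ∫⁻ z, ‖B.e n z‖ₑ ^ 2 ∂μ = ∫⁻ y, ‖y‖ₑ ^ 2 ∂(gaussianReal 0 1) := by
  have h : μ.map (B.e n) = gaussianReal 0 1 := by
    rw [hW.gaussian, B.orthonormal.nnnorm_eq_one n, one_pow]
  rw [← h, lintegral_map (by fun_prop) (by fun_prop)]

/-- Cauchy-Schwarz with half of each weight on either factor reduces this to the second moments of
the `e_n`, which are all standard normal, and to summability of the weights. -/
lemma lintegral_tsum_e_sq_ne_top (hW : IsAbstractWienerSpace i μ) (B : CarmonaBasis i x) :
    ∫⁻ z, (∑' n : ℕ, (2 : ℝ≥0∞) ^ (-(((n : ℝ) + 1) / 2)) * ‖B.e n z‖ₑ) ^ 2 ∂μ ≠ ∞ := by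
  set c : ℕ → ℝ≥0∞ := fun n => (2 : ℝ≥0∞) ^ (-(((n : ℝ) + 1) / 2)) with hc
  have hsq : ∀ n, (c n ^ (1 / 2 : ℝ)) ^ 2 = c n := fun n => by
    rw [← ENNReal.rpow_natCast, ← ENNReal.rpow_mul]
    norm_num
  have hle : ∀ z, (∑' n, c n * ‖B.e n z‖ₑ) ^ 2 ≤ (∑' n, c n) * ∑' n, c n * ‖B.e n z‖ₑ ^ 2 := by
    intro z
    have h := tsum_mul_sq_le (fun n => c n ^ (1 / 2 : ℝ)) fun n => c n ^ (1 / 2 : ℝ) * ‖B.e n z‖ₑ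
    simpa only [← mul_assoc, ← sq, mul_pow, hsq] using h
  refine ne_top_of_le_ne_top ?_ (lintegral_mono hle)
  rw [lintegral_const_mul _ (by fun_prop), lintegral_tsum (by fun_prop)]
  refine ENNReal.mul_ne_top tsum_two_rpow_ne_top ?_
  have : ∀ n, ∫⁻ z, c n * ‖B.e n z‖ₑ ^ 2 ∂μ = c n * ∫⁻ y, ‖y‖ₑ ^ 2 ∂(gaussianReal 0 1) :=
    fun n => by rw [lintegral_const_mul _ (by fun_prop), hW.lintegral_e_sq]
  rw [tsum_congr this, ENNReal.tsum_mul_right]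
  refine ENNReal.mul_ne_top tsum_two_rpow_ne_top ?_
  have h := (memLp_id_gaussianReal (μ := 0) (v := 1) 2).2
  rw [eLpNorm_lt_top_iff_lintegral_rpow_enorm_lt_top (by simp) (by simp)] at h
  simpa using h.ne

lemma lintegral_q_sq_ne_top (hW : IsAbstractWienerSpace i μ) (hν : B.IsAdmissible μ ν) :
    ∫⁻ z, B.q ν z ^ 2 ∂μ ≠ ∞ := by
  simp only [CarmonaBasis.q_sq]
  rw [lintegral_add_left (by fun_prop), lintegral_tsum (by fun_prop)]
  refine ENNReal.add_ne_top.2 ⟨?_, hW.lintegral_tsum_e_sq_ne_top B⟩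
  have : ∀ n, ∫⁻ z, (2 : ℝ≥0∞) ^ n * ‖B.incr ν n z‖ₑ ^ 2 ∂μ =
      2 ^ n * ∫⁻ z, ‖B.incr ν n z‖ₑ ^ 2 ∂μ := fun n => lintegral_const_mul _ (by fun_prop)
  rw [tsum_congr this]
  exact hW.tsum_lintegral_incr_ne_top hν

lemma memLp_q (hW : IsAbstractWienerSpace i μ) (hν : B.IsAdmissible μ ν) :
    MemLp (B.q ν) 2 μ := by
  refine ⟨(measurable_q B ν).aestronglyMeasurable, ?_⟩
  rw [eLpNorm_lt_top_iff_lintegral_rpow_enorm_lt_top (by simp) (by simp)]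
  simpa using (hW.lintegral_q_sq_ne_top hν).lt_top

lemma measurableSet_q_lt_top (B : CarmonaBasis i x) (ν : ℕ → ℕ) :
    MeasurableSet {z | B.q ν z < ∞} :=
  measurableSet_lt (measurable_q B ν) measurable_const

lemma ae_q_lt_top (hW : IsAbstractWienerSpace i μ) (hν : B.IsAdmissible μ ν) :
    ∀ᵐ z ∂μ, B.q ν z < ∞ := by
  filter_upwards [ae_lt_top ((measurable_q B ν).pow_const 2) (hW.lintegral_q_sq_ne_top hν)]
    with z hz
  exact (ENNReal.pow_lt_top_iff.1 hz).resolve_right two_ne_zero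

lemma measure_q_lt_top (hW : IsAbstractWienerSpace i μ) (hν : B.IsAdmissible μ ν) :
    μ {z | B.q ν z < ∞} = 1 := by
  have := hW.isGaussian
  rw [measure_eq_measure_of_null_sdiff (Set.subset_univ _) ?_, measure_univ]
  rw [← Set.compl_eq_univ_sdiff]
  exact hW.ae_q_lt_top hν

/-- A functional `l` on `E_x` need not extend to `E`, but `l ∘ j ∘ Q̃_m` is defined on all of `E`
and converges to `l` pointwise on `E_x`. Its representative in `H` is the projection of that of `l`,
so the norms converge too, and the characteristic functions are computed in the limit in two ways.
-/
lemma charFunDual_comap_incl {j : H →L[ℝ] B.Space ν} (hj : ∀ h, B.incl ν (j h) = i h)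
    (hν : StrictMono ν) (hW : IsAbstractWienerSpace i μ)
    (hincl : MeasurableEmbedding (B.incl ν)) (hmap : (μ.comap (B.incl ν)).map (B.incl ν) = μ)
    (l : StrongDual ℝ (B.Space ν)) :
    charFunDual (μ.comap (B.incl ν)) l = Complex.exp (-(‖dualToH j l‖ : ℂ) ^ 2 / 2) := by
  have := hW.isGaussian
  have hprob : IsProbabilityMeasure (μ.comap (B.incl ν)) := ⟨by
    rw [← Set.preimage_univ (f := B.incl ν), ← Measure.map_apply hincl.measurable .univ, hmap,
      measure_univ]⟩
  let lm : ℕ → StrongDual ℝ E := fun m => (l.comp j).comp (B.proj (ν m))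
  have hlm : ∀ m, dualToH i (lm m) = B.proj (ν m) (i (dualToH j l)) := fun m => by
    refine ext_inner_right ℝ fun h => ?_
    rw [inner_dualToH, CarmonaBasis.inner_proj_left, inner_dualToH]
    rfl
  have h1 : Tendsto (fun m => charFunDual μ (lm m)) atTop
      (𝓝 (Complex.exp (-(‖dualToH j l‖ : ℂ) ^ 2 / 2))) := by
    simp only [hW.charFunDual_eq, hlm]
    have hn : Tendsto (fun m => ‖B.proj (ν m) (i (dualToH j l))‖) atTop (𝓝 ‖dualToH j l‖) :=
      ((B.tendsto_proj (dualToH j l)).comp hν.tendsto_atTop).norm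
    have hc : Continuous fun r : ℝ => Complex.exp (-(r : ℂ) ^ 2 / 2) := by fun_prop
    exact (hc.tendsto _).comp hn
  have h2 : Tendsto (fun m => charFunDual μ (lm m)) atTop
      (𝓝 (charFunDual (μ.comap (B.incl ν)) l)) := by
    have heq : ∀ m, charFunDual μ (lm m) =
        ∫ w, Complex.exp ((lm m (B.incl ν w) : ℂ) * Complex.I) ∂(μ.comap (B.incl ν)) := fun m => by
      rw [charFunDual_apply]
      conv_lhs => rw [← hmap]
      exact hincl.integral_map _
    simp only [heq]
    rw [charFunDual_apply]
    refine tendsto_integral_of_dominated_convergence (fun _ => 1) (fun m => ?_)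
      (integrable_const 1) (fun m => ?_) (Eventually.of_forall fun w => ?_)
    · have hm : Measurable fun w => lm m (B.incl ν w) :=
        (lm m).continuous.measurable.comp hincl.measurable
      exact (by fun_prop : Measurable fun w =>
        Complex.exp ((lm m (B.incl ν w) : ℂ) * Complex.I)).aestronglyMeasurable
    · exact Eventually.of_forall fun w => (Complex.norm_exp_ofReal_mul_I _).le
    · have hc : Continuous fun r : ℝ => Complex.exp ((r : ℂ) * Complex.I) := by fun_prop
      exact (hc.tendsto _).comp ((l.continuous.tendsto w).comp (B.tendsto_embedding_proj hν hj w))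
  exact tendsto_nhds_unique h2 h1

/-- `(E_x, H, μ)` is an abstract Wiener space. -/
lemma isAbstractWienerSpace_space (hW : IsAbstractWienerSpace i μ) (hν : B.IsAdmissible μ ν)
    {j : H →L[ℝ] B.Space ν} (hj : ∀ h, B.incl ν (j h) = i h) :
    IsAbstractWienerSpace j (μ.comap (B.incl ν)) := by
  have := hW.complete
  have := hW.separable
  have := hW.isGaussian
  have hcomp := B.completeSpace hν.strictMono hν.zero
  have hdense : DenseRange j := fun z => mem_closure_of_tendsto
    (B.tendsto_embedding_proj hν.strictMono hj z)
    (Eventually.of_forall fun m => Set.mem_range_self _)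
  have hsep : TopologicalSpace.SeparableSpace (B.Space ν) := hdense.separableSpace j.continuous
  have : SecondCountableTopology (B.Space ν) := UniformSpace.secondCountable_of_separable _
  -- By Lusin-Souslin, a continuous injection of the Polish space `E_x` maps Borel sets to Borel
  -- sets, so `comap` really is the restriction of `μ`.
  have hincl : MeasurableEmbedding (B.incl ν) :=
    (B.inclL hν.strictMono hν.zero).continuous.measurableEmbedding (B.incl_injective ν)
  have hmap : (μ.comap (B.incl ν)).map (B.incl ν) = μ := by
    rw [hincl.map_comap, Measure.restrict_eq_self_of_ae_mem]
    filter_upwards [hW.ae_q_lt_top hν] with z hz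
    obtain ⟨w, hw⟩ := B.exists_incl_eq hz.ne
    exact ⟨w, hw⟩
  refine ⟨hW.separable, hcomp, fun g h hgh => hW.injective ?_, hdense, fun l => ?_⟩
  · rw [← hj, ← hj, hgh]
  · have hprob : IsProbabilityMeasure (μ.comap (B.incl ν)) := ⟨by
      rw [← Set.preimage_univ (f := B.incl ν), ← Measure.map_apply hincl.measurable .univ, hmap,
        measure_univ]⟩
    have : IsProbabilityMeasure ((μ.comap (B.incl ν)).map l) :=
      Measure.isProbabilityMeasure_map (by fun_prop)
    refine Measure.ext_of_charFun (funext fun t => ?_)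
    rw [charFun_map_eq_charFunDual_smul, charFunDual_comap_incl hj hν.strictMono hW hincl hmap,
      charFun_gaussianReal, dualToH_smul, norm_smul]
    congr 1
    have : ((‖t‖ : ℝ) : ℂ) ^ 2 = (t : ℂ) ^ 2 := by
      rw [← Complex.ofReal_pow, Real.norm_eq_abs, sq_abs, Complex.ofReal_pow]
    push_cast
    rw [mul_pow, this]
    simp
    ring

end IsAbstractWienerSpace

end AbstractWiener

end

theorem proposition2p3 {H E : Type*}
    [NormedAddCommGroup H] [InnerProductSpace ℝ H] [CompleteSpace H]
    [NormedAddCommGroup E] [NormedSpace ℝ E] [MeasurableSpace E] [BorelSpace E]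
    (i : H →L[ℝ] E) (μ : Measure E) (hW : AbstractWiener.IsAbstractWienerSpace i μ)
    (x : E) (hx : x ∉ Set.range i) :
    -- the data that enter the definition of `q_x` exist ...
    Nonempty (AbstractWiener.CarmonaBasis i x) ∧
    ∀ B : AbstractWiener.CarmonaBasis i x,
      (∃ ν : ℕ → ℕ, B.IsAdmissible μ ν) ∧
      -- ... and for every choice of them the following holds
      ∀ ν : ℕ → ℕ, B.IsAdmissible μ ν →
        -- `E_x` is Borel and has full measure
        (MeasurableSet {z | B.q ν z < ∞} ∧ μ {z | B.q ν z < ∞} = 1) ∧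
        -- bound on `H`
        ((∀ h : H, B.q ν (i h) ≤ ENNReal.ofReal (√(2 + ‖i‖ ^ 2) * ‖h‖)) ∧
          (‖i‖ ≤ 1 → ∀ h : H, B.q ν (i h) ≤ ENNReal.ofReal (√3 * ‖h‖))) ∧
        -- norm comparison, completeness, compact embedding
        ((∀ z : E, ‖z‖ₑ ≤ ENNReal.ofReal √2 * B.q ν z) ∧
          CompleteSpace (B.Space ν) ∧
          IsCompactOperator (B.incl ν)) ∧
        -- `(E_x, H, μ)` is an abstract Wiener space and `q_x` is square integrable
        ((∃ j : H →L[ℝ] B.Space ν, (∀ h, B.incl ν (j h) = i h) ∧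
            AbstractWiener.IsAbstractWienerSpace j (μ.comap (B.incl ν))) ∧
          MemLp (B.q ν) 2 μ) := by
  have := hW.separable
  have := hW.complete
  refine ⟨AbstractWiener.exists_carmonaBasis hW.injective hW.dense hx, fun B =>
    ⟨hW.exists_isAdmissible B, fun ν hν => ⟨⟨?_, hW.measure_q_lt_top hν⟩,
      ⟨B.q_apply_le hν, B.q_apply_le_of_norm_le_one hν⟩,
      ⟨B.enorm_le_q hν.strictMono hν.zero, B.completeSpace hν.strictMono hν.zero,
        B.isCompactOperator_incl hν.strictMono hν.zero⟩, ?_, hW.memLp_q hν⟩⟩⟩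
  · exact AbstractWiener.IsAbstractWienerSpace.measurableSet_q_lt_top B ν
  · obtain ⟨j, hj⟩ := B.exists_embedding hν
    exact ⟨j, hj, hW.isAbstractWienerSpace_space hν hj⟩
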